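/- Conventions. Let $A$ be an integer $d\times n$ matrix with columns $a_1,\dots,a_n$ whose row span contains the all-ones vector, let $P=\mathrm{conv}(a_1,\dots,a_n)$, and for $w\in(\mathbb C^*)^n$ let $f_w(\theta)=\sum_i w_i\theta^{a_i}$. Let $\nabla_A\subseteq(\mathbb C^*)^n$ be the Zariski closure in $(\mathbb C^*)^n$ of the set of $w$ for which there is $\theta\in(\mathbb C^*)^d$ with $f_w(\theta)=\partial f_w/\partial\theta_k(\theta)=0$ for all $k$. The $A$-discriminant $\Delta_A\in\mathbb C[w_1,\dots,w_n]$ is the irreducible polynomial vanishing on $\nabla_A$, unique up to a nonzero scalar, if $\nabla_A$ has codimension one, and $\Delta_A=1$ otherwise. For a face $\Gamma$ of $P$, $\Gamma\cap A$ is the matrix of the columns of $A$ lying in $\Gamma$. The principal $A$-determinant is $$E_A=\prod_{\Gamma}\Delta_{\Gamma\cap A}^{\,i(\Gamma,A)\,u(S/\Gamma)},$$ the product over all nonempty faces $\Gamma$ of $P$ including $P$ itself (Gelfand–Kapranov–Zelevinsky). Here, with $\Xi=\mathbb Z A$ and $S=\mathbb N A$, $i(\Gamma,A)$ is the index of the lattice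 generated by $\Gamma\cap A$ in $\Xi\cap\mathrm{Lin}_{\mathbb R}(\Gamma)$, $S/\Gamma$ is the image of $S$ in $\Xi/(\Xi\cap\mathrm{Lin}_{\mathbb R}(\Gamma))$, and $u(S/\Gamma)$ is the volume of $\mathrm{conv}(S/\Gamma)\setminus\mathrm{conv}((S/\Gamma)\setminus\{0\})$, normalized so that unimodular simplices have volume $1$. If $X_A$ is smooth, all exponents are $1$; in general $\prod_\Gamma\Delta_{\Gamma\cap A}$ is the radical of $E_A$. All equalities below are up to a nonzero scalar. Theorem. Let $d\ge 4$ and let $A$ be the $d\times\binom d2$ matrix with columns $e_i+e_j$, $1\le i<j\le d$, whose convex hull is the second hypersimplex $\Delta_{2,d}$. Let $w_{ij}$ be the corresponding variables, let $W$ be the symmetric $d\times d$ matrix with zero diagonal and entries $W_{ij}=W_{ji}=w_{ij}$ for $i<j$, and for $E\subseteq[d]$ let $W_E$ be the principal submatrix of $W$ with rows and columns in $E$. Let $U^2_E$ be the uniform matroid of rank two on $E$, let $P(U^2_E)$ be its matroid base polytope, and let $\Delta(U^2_E)=\Delta_{P(U^2_E)\cap A}$. Then: 1. The principal $A$-determinant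 of $\Delta_{2,d}$ is $$E_A=\prod_{\substack{E\subseteq[d]\\|E|\ge4}}\Delta(U^2_E).$$ 2. For every $E\subseteq[d]$ with $|E|\ge4$, $P(U^2_E)$ is a face of $\Delta_{2,d}$ and $\Delta(U^2_E)=\det W_E$. 3. Hence $E_A=\prod_{|E|\ge4}\det W_E$, and the product $\prod_\Gamma\Delta_{\Gamma\cap A}$ without exponents is equal to the same polynomial. 4. For a nonempty face $\Gamma$ of $\Delta_{2,d}$, the factor $\Delta_{\Gamma\cap A}^{\,i(\Gamma,A)u(S/\Gamma)}$ is not a unit (that is, not a nonzero constant) if and only if $\Gamma$ is the matroid base polytope of a deletion $U^2_{[d]}\setminus D$ for some $D\subseteq[d]$ with $|[d]\setminus D|\ge4$. -/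

import Mathlib

noncomputable section

/-! ### The `A`-discriminant -/

/-- The (Laurent) polynomial `f_w(θ) = ∑ᵢ wᵢ θ^{aᵢ}`, where the family `A` lists the columns `aᵢ ∈ ℤᵈ`. -/
def laurentSum {ι : Type} [Fintype ι] {d : ℕ} (A : ι → Fin d → ℤ) (w : ι → ℂ) (θ : Fin d → ℂ) : ℂ :=
  ∑ i, w i * ∏ k, θ k ^ A i k

/-- The `w ∈ (ℂ*)ⁿ` for which `f_w = 0` has a singular point in `(ℂ*)ᵈ`. -/
def singularScalings {ι : Type} [Fintype ι] {d : ℕ} (A : ι → Fin d → ℤ) : Set (ι → ℂ) :=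
  {w | (∀ i, w i ≠ 0) ∧ ∃ θ : Fin d → ℂ, (∀ k, θ k ≠ 0) ∧ laurentSum A w θ = 0 ∧
    ∀ k, deriv (fun t : ℂ => laurentSum A w (Function.update θ k t)) (θ k) = 0}

/-- `∇_A`: the Zariski closure of `singularScalings A` in the torus `(ℂ*)ⁿ`. -/
def discriminantLocus {ι : Type} [Fintype ι] {d : ℕ} (A : ι → Fin d → ℤ) : Set (ι → ℂ) :=
  {w | (∀ i, w i ≠ 0) ∧
    w ∈ MvPolynomial.zeroLocus ℂ (MvPolynomial.vanishingIdeal ℂ (singularScalings A))}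

/-- `Δ` is an irreducible polynomial vanishing on `∇_A`, and `∇_A` has codimension one
(the vanishing ideal of `∇_A` has height one; it is the unit ideal, of height `⊤`,
if `∇_A` is empty). -/
def IsADiscriminant {ι : Type} [Fintype ι] {d : ℕ} (A : ι → Fin d → ℤ)
    (Δ : MvPolynomial ι ℂ) : Prop :=
  (MvPolynomial.vanishingIdeal ℂ (discriminantLocus A)).height = 1 ∧
    Irreducible Δ ∧ ∀ w ∈ discriminantLocus A, MvPolynomial.eval w Δ = 0

open scoped Classical in
/-- The `A`-discriminant, well defined up to a nonzero scalar; it is `1` if `∇_A` is not of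
codimension one. -/
def aDiscriminant {ι : Type} [Fintype ι] {d : ℕ} (A : ι → Fin d → ℤ) : MvPolynomial ι ℂ :=
  if h : ∃ Δ, IsADiscriminant A Δ then h.choose else 1

/-! ### Polytopes and faces -/

/-- The inclusion `ℤᵈ ⊆ ℝᵈ`. -/
def toReal (d : ℕ) : (Fin d → ℤ) →ₗ[ℤ] (Fin d → ℝ) :=
  (Algebra.linearMap ℤ ℝ).compLeft (Fin d)

/-- `P = conv(a₁, …, aₙ)`. -/
def configPolytope {ι : Type} {d : ℕ} (A : ι → Fin d → ℤ) : Set (Fin d → ℝ) :=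
  convexHull ℝ (Set.range fun i => toReal d (A i))

/-- The nonempty faces of a polytope, including the polytope itself. -/
def faces {d : ℕ} (P : Set (Fin d → ℝ)) : Set (Set (Fin d → ℝ)) :=
  {Γ | IsExposed ℝ P Γ ∧ Γ.Nonempty}

open scoped Classical in
/-- `Γ ∩ A`, as the set of indices of the columns of `A` that lie in `Γ`. -/
def faceColumns {ι : Type} [Fintype ι] {d : ℕ} (A : ι → Fin d → ℤ) (Γ : Set (Fin d → ℝ)) :
    Finset ι :=
  Finset.univ.filter fun i => toReal d (A i) ∈ Γ

/-- A face is the convex hull of the columns that it contains. -/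
theorem face_eq_convexHull {ι : Type} [Fintype ι] {d : ℕ} (A : ι → Fin d → ℤ)
    {Γ : Set (Fin d → ℝ)} (hΓ : Γ ∈ faces (configPolytope A)) :
    Γ = convexHull ℝ ((fun i => toReal d (A i)) '' (faceColumns A Γ : Set ι)) := by
  classical
  obtain ⟨hexp, hne⟩ := hΓ
  have hconv : Convex ℝ Γ := hexp.convex (convex_convexHull ℝ _)
  have hsub : Γ ⊆ configPolytope A := hexp.subset
  obtain ⟨l, hl⟩ := hexp hne
  apply Set.Subset.antisymm
  · intro x hx
    have hxP : x ∈ configPolytope A := hsub hx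
    have hxmax : ∀ y ∈ configPolytope A, l y ≤ l x := by
      rw [hl] at hx
      exact hx.2
    obtain ⟨κ, _, c, z, hc0, hc1, hz, hcx⟩ := mem_convexHull_iff_exists_fintype.mp hxP
    have hmem : ∀ i, z i ∈ configPolytope A := fun i => subset_convexHull ℝ _ (hz i)
    have hlx : ∑ i, c i * (l x - l (z i)) = 0 := by
      have h2 : l x = ∑ i, c i * l (z i) := by
        conv_lhs => rw [← hcx]
        simp [map_sum]
      simp only [mul_sub, Finset.sum_sub_distrib]
      rw [← Finset.sum_mul, hc1, one_mul, ← h2, sub_self]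
    have hzero := (Finset.sum_eq_zero_iff_of_nonneg (fun i _ =>
      mul_nonneg (hc0 i) (sub_nonneg.mpr (hxmax _ (hmem i))))).mp hlx
    have hin : ∀ i, c i ≠ 0 → z i ∈ Γ := by
      intro i hi
      have h4 : l x = l (z i) := by
        rcases mul_eq_zero.mp (hzero i (Finset.mem_univ i)) with h | h
        · exact absurd h hi
        · linarith
      rw [hl]
      exact ⟨hmem i, fun y hy => h4 ▸ hxmax y hy⟩
    rw [← hcx, ← Finset.sum_filter_of_ne (p := fun i => c i ≠ 0)
      (fun i _ h hc => h (by rw [hc, zero_smul]))]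
    refine (convex_convexHull ℝ _).sum_mem (fun i _ => hc0 i) ?_ fun i hi => ?_
    · rw [Finset.sum_filter_ne_zero, hc1]
    · obtain ⟨j, hj⟩ := hz i
      refine subset_convexHull ℝ _ ⟨j, ?_, hj⟩
      have := hin i (Finset.mem_filter.mp hi).2
      simpa [faceColumns, ← hj] using this
  · refine convexHull_min ?_ hconv
    rintro _ ⟨i, hi, rfl⟩
    simpa [faceColumns] using hi

theorem finite_faces {ι : Type} [Fintype ι] {d : ℕ} (A : ι → Fin d → ℤ) :
    (faces (configPolytope A)).Finite := by
  refine Set.Finite.of_finite_image (f := faceColumns A) (Set.toFinite _) ?_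
  intro Γ hΓ Γ' hΓ' h
  rw [face_eq_convexHull A hΓ, face_eq_convexHull A hΓ', h]

/-- `Δ_{Γ ∩ A}`, as a polynomial in all the scaling variables. -/
def faceDiscriminant {ι : Type} [Fintype ι] {d : ℕ} (A : ι → Fin d → ℤ) (Γ : Set (Fin d → ℝ)) :
    MvPolynomial ι ℂ :=
  MvPolynomial.rename Subtype.val (aDiscriminant fun i : faceColumns A Γ => A i)

/-! ### The exponents of the principal `A`-determinant -/

/-- The lattice generated by the columns of `A`. -/
def columnLattice {ι : Type} {d : ℕ} (A : ι → Fin d → ℤ) : Submodule ℤ (Fin d → ℤ) :=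
  Submodule.span ℤ (Set.range A)

/-- The lattice generated by the columns of `A` on `Γ`. -/
def faceLattice {ι : Type} [Fintype ι] {d : ℕ} (A : ι → Fin d → ℤ) (Γ : Set (Fin d → ℝ)) :
    Submodule ℤ (Fin d → ℤ) :=
  Submodule.span ℤ (A '' (faceColumns A Γ : Set ι))

/-- The points of the column lattice in the real linear span of the columns on `Γ`. -/
def saturatedFaceLattice {ι : Type} [Fintype ι] {d : ℕ} (A : ι → Fin d → ℤ)
    (Γ : Set (Fin d → ℝ)) : Submodule ℤ (columnLattice A) :=
  ((Submodule.span ℝ (toReal d '' (A '' (faceColumns A Γ : Set ι)))).restrictScalars ℤ).comap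
    ((toReal d).comp (columnLattice A).subtype)

/-- The lattice index `i(Γ, A)`. -/
def faceIndex {ι : Type} [Fintype ι] {d : ℕ} (A : ι → Fin d → ℤ) (Γ : Set (Fin d → ℝ)) : ℕ :=
  (faceLattice A Γ).toAddSubgroup.relIndex
    ((saturatedFaceLattice A Γ).map (columnLattice A).subtype).toAddSubgroup

/-- The quotient of the column lattice by its part in the linear span of `Γ`. -/
abbrev QuotientLattice {ι : Type} [Fintype ι] {d : ℕ} (A : ι → Fin d → ℤ)
    (Γ : Set (Fin d → ℝ)) : Type :=
  columnLattice A ⧸ saturatedFaceLattice A Γ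

instance quotientLattice_isTorsionFree {ι : Type} [Fintype ι] {d : ℕ} (A : ι → Fin d → ℤ)
    (Γ : Set (Fin d → ℝ)) : Module.IsTorsionFree ℤ (QuotientLattice A Γ) := by
  refine Module.IsTorsionFree.of_smul_eq_zero fun n x hx => ?_
  obtain ⟨y, rfl⟩ := Submodule.mkQ_surjective _ x
  rw [← map_smul, Submodule.mkQ_apply, Submodule.Quotient.mk_eq_zero] at hx
  refine or_iff_not_imp_left.mpr fun hn => ?_
  rw [Submodule.mkQ_apply, Submodule.Quotient.mk_eq_zero]
  have hn' : (n : ℝ) ≠ 0 := by exact_mod_cast hn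
  simp only [saturatedFaceLattice, Submodule.mem_comap, Submodule.restrictScalars_mem,
    map_smul] at hx ⊢
  rw [← Int.cast_smul_eq_zsmul ℝ] at hx
  exact (Submodule.smul_mem_iff _ hn').mp hx

/-- The semigroup `S/Γ`: the image in the quotient lattice of the semigroup (with `0`) generated
by the columns of `A`. -/
def quotientSemigroup {ι : Type} [Fintype ι] {d : ℕ} (A : ι → Fin d → ℤ)
    (Γ : Set (Fin d → ℝ)) : AddSubmonoid (QuotientLattice A Γ) :=
  AddSubmonoid.closure (Set.range fun i =>
    (saturatedFaceLattice A Γ).mkQ ⟨A i, Submodule.subset_span ⟨i, rfl⟩⟩)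

/-- Real coordinates of a quotient lattice point with respect to a lattice basis. -/
def quotientCoords {ι : Type} [Fintype ι] {d : ℕ} (A : ι → Fin d → ℤ) (Γ : Set (Fin d → ℝ))
    (x : QuotientLattice A Γ) : Fin (Module.finrank ℤ (QuotientLattice A Γ)) → ℝ :=
  fun j => ((Module.finBasis ℤ (QuotientLattice A Γ)).repr x j : ℝ)

/-- The subdiagram volume `u(S/Γ)`: the volume of `conv(S/Γ) ∖ conv(S/Γ ∖ {0})`, normalized so
that a unimodular simplex of the quotient lattice has volume `1`. This number is a natural number
(`Nat.floor` only reads it as such) and does not depend on the lattice basis. -/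
def subdiagramVolume {ι : Type} [Fintype ι] {d : ℕ} (A : ι → Fin d → ℤ)
    (Γ : Set (Fin d → ℝ)) : ℕ :=
  ⌊(Nat.factorial (Module.finrank ℤ (QuotientLattice A Γ)) : ℝ) *
    (MeasureTheory.volume
      (convexHull ℝ (quotientCoords A Γ '' (quotientSemigroup A Γ : Set (QuotientLattice A Γ))) \
        convexHull ℝ (quotientCoords A Γ ''
          ((quotientSemigroup A Γ : Set (QuotientLattice A Γ)) \ {0})))).toReal⌋₊

/-- The exponent `i(Γ, A) · u(S/Γ)` of `Δ_{Γ ∩ A}` in the principal `A`-determinant; it is the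
multiplicity of the toric variety `X_A` along the torus orbit of `Γ`, hence `1` if `X_A` is
smooth. -/
def faceExponent {ι : Type} [Fintype ι] {d : ℕ} (A : ι → Fin d → ℤ) (Γ : Set (Fin d → ℝ)) : ℕ :=
  faceIndex A Γ * subdiagramVolume A Γ

/-- The principal `A`-determinant `E_A`, by its Gelfand–Kapranov–Zelevinsky factorization over
the nonempty faces of `P`. -/
def principalADeterminant {ι : Type} [Fintype ι] {d : ℕ} (A : ι → Fin d → ℤ) :
    MvPolynomial ι ℂ :=
  ∏ Γ ∈ (finite_faces A).toFinset, faceDiscriminant A Γ ^ faceExponent A Γ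

/-- The product `∏_Γ Δ_{Γ ∩ A}` over the nonempty faces of `P`, without exponents: it is `E_A` if
`X_A` is smooth, and the radical of `E_A` in general. -/
def reducedPrincipalADeterminant {ι : Type} [Fintype ι] {d : ℕ} (A : ι → Fin d → ℤ) :
    MvPolynomial ι ℂ :=
  ∏ Γ ∈ (finite_faces A).toFinset, faceDiscriminant A Γ

/-! ### The second hypersimplex and rank two uniform matroids -/

/-- The pairs `i < j` in `[d]`. -/
abbrev Pairs (d : ℕ) : Type := {p : Fin d × Fin d // p.1 < p.2}

/-- The columns `eᵢ + eⱼ`, `i < j`; their convex hull is the second hypersimplex `Δ_{2,d}`. -/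
def hypersimplexColumns (d : ℕ) : Pairs d → Fin d → ℤ :=
  fun p => Pi.single p.1.1 1 + Pi.single p.1.2 1

/-- The symmetric zero-diagonal `d × d` matrix `W` of the scaling variables `w_{ij}`. -/
def scalingMatrix (d : ℕ) : Matrix (Fin d) (Fin d) (MvPolynomial (Pairs d) ℂ) :=
  fun i j =>
    if h : i < j then MvPolynomial.X ⟨(i, j), h⟩
    else if h : j < i then MvPolynomial.X ⟨(j, i), h⟩
    else 0

/-- The principal submatrix `W_E`. -/
def scalingSubmatrix {d : ℕ} (E : Finset (Fin d)) : Matrix E E (MvPolynomial (Pairs d) ℂ) :=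
  (scalingMatrix d).submatrix Subtype.val Subtype.val

/-- The uniform matroid `U^r_E`: the independent sets are the subsets of `E` with at most `r`
elements. -/
def uniformMatroid {d : ℕ} (r : ℕ) (E : Finset (Fin d)) : Matroid (Fin d) :=
  (IndepMatroid.ofFinite (E := (E : Set (Fin d))) E.finite_toSet
    (fun I => I ⊆ (E : Set (Fin d)) ∧ I.ncard ≤ r)
    (by simp)
    (fun I J hJ hIJ => ⟨hIJ.trans hJ.1, (Set.ncard_le_ncard hIJ (Set.toFinite J)).trans hJ.2⟩)
    (by
      intro I J hI hJ hlt
      obtain ⟨e, heJ, heI⟩ := Set.exists_mem_notMem_of_ncard_lt_ncard hlt (Set.toFinite I)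
      refine ⟨e, heJ, heI, Set.insert_subset (hJ.1 heJ) hI.1, ?_⟩
      rw [Set.ncard_insert_of_notMem heI (Set.toFinite I)]
      omega)
    (fun I hI => hI.1)).matroid

/-- The base polytope of a matroid: the convex hull of the indicator vectors of its bases. -/
def matroidPolytope {d : ℕ} (M : Matroid (Fin d)) : Set (Fin d → ℝ) :=
  convexHull ℝ {x | ∃ B, M.IsBase B ∧ x = B.indicator 1}

end

noncomputable section

open Matrix

/-! ### Symmetric matrices with zero diagonal, from edge weights -/

/-- The symmetric matrix with zero diagonal whose off-diagonal entries are the weights `w`. -/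
def edgeMatrix {V σ R : Type*} [DecidableEq V] [Zero R] (e : σ ≃ {z : Sym2 V // ¬ z.IsDiag})
    (w : σ → R) : Matrix V V R :=
  fun i j => if h : i = j then 0 else w (e.symm ⟨s(i, j), by simpa using h⟩)

/-- The edge weights of a symmetric matrix. -/
def edgeWeights {V σ R : Type*} (e : σ ≃ {z : Sym2 V // ¬ z.IsDiag})
    (N : Matrix V V R) (hN : ∀ i j, N i j = N j i) (s : σ) : R :=
  Sym2.lift ⟨N, hN⟩ (e s).1

open scoped Classical in
/-- Multiply the weights of the edges at `v` by `t`. -/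
def rowScale {V σ R : Type*} [Mul R] (e : σ ≃ {z : Sym2 V // ¬ z.IsDiag}) (v : V) (t : R)
    (w : σ → R) (s : σ) : R :=
  if v ∈ (e s).1 then t * w s else w s

section EdgeMatrix

variable {V σ : Type*} [DecidableEq V] (e : σ ≃ {z : Sym2 V // ¬ z.IsDiag})

theorem edgeMatrix_symm {R : Type*} [Zero R] (w : σ → R) (i j : V) :
    edgeMatrix e w i j = edgeMatrix e w j i := by
  simp only [edgeMatrix, Sym2.eq_swap (a := i) (b := j), eq_comm (a := i) (b := j)]

theorem edgeMatrix_edgeWeights {R : Type*} [Zero R] (N : Matrix V V R)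
    (hN : ∀ i j, N i j = N j i) (h0 : ∀ i, N i i = 0) :
    edgeMatrix e (edgeWeights e N hN) = N := by
  ext i j
  by_cases h : i = j
  · subst h; simp [edgeMatrix, h0]
  · simp [edgeMatrix, edgeWeights, h]

theorem edgeMatrix_map [Fintype V] {R S : Type*} [Semiring R] [Semiring S] (f : R →+* S) (w : σ → R) :
    f.mapMatrix (edgeMatrix e w) = edgeMatrix e (fun s => f (w s)) := by
  ext i j
  by_cases h : i = j <;> simp [edgeMatrix, h]

/-- A congruence by a diagonal matrix would scale the entry at `(v, v)` by `t ^ 2`; the zero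
diagonal is what makes it agree with scaling the edges at `v` once. -/
theorem edgeMatrix_rowScale {R : Type*} [CommRing R] [Fintype V] (v : V) (t : R) (w : σ → R) :
    edgeMatrix e (rowScale e v t w) =
      diagonal (Function.update 1 v t) * edgeMatrix e w * diagonal (Function.update 1 v t) := by
  ext i j
  rw [mul_diagonal, diagonal_mul]
  by_cases h : i = j
  · simp [edgeMatrix, h]
  · by_cases hi : v = i
    · subst hi; simp [edgeMatrix, h, rowScale, Function.update_of_ne (Ne.symm h)]
    · by_cases hj : v = j
      · subst hj; simp [edgeMatrix, h, rowScale, mul_comm]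
      · simp [edgeMatrix, h, rowScale, hi, hj, Function.update_of_ne (Ne.symm hi),
          Function.update_of_ne (Ne.symm hj)]

theorem det_edgeMatrix_rowScale {R : Type*} [CommRing R] [Fintype V] (v : V) (t : R) (w : σ → R) :
    (edgeMatrix e (rowScale e v t w)).det = (edgeMatrix e w).det * t ^ 2 := by
  have h : ∏ i, Function.update (1 : V → R) v t i = t := by
    rw [Finset.prod_update_of_mem (Finset.mem_univ v)]; simp
  rw [edgeMatrix_rowScale, det_mul, det_mul, det_diagonal, h]
  ring

variable [Fintype V]

theorem eval_det_edgeMatrix (w : σ → ℂ) :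
    MvPolynomial.eval w (edgeMatrix e (MvPolynomial.X (R := ℂ))).det = (edgeMatrix e w).det := by
  rw [RingHom.map_det, edgeMatrix_map]
  simp

end EdgeMatrix

/-! ### The adjacency matrix of the complete graph -/

/-- The matrix with zero diagonal and all other entries `1`. -/
def completeMatrix (U : Type*) [DecidableEq U] : Matrix U U ℂ :=
  fun i j => if i = j then 0 else 1

section CompleteMatrix

variable {U : Type*} [DecidableEq U] [Fintype U]

/-- The matrix is `J - 1` with `J` all ones and `J² = m J` for `m` the size, so `J / (m - 1) - 1`
inverts it. -/
theorem completeMatrix_mul_inverse (h : 2 ≤ Fintype.card U) :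
    completeMatrix U * of (fun i j : U => ((Fintype.card U : ℂ) - 1)⁻¹ - if i = j then 1 else 0) = 1 := by
  have hc : (Fintype.card U : ℂ) - 1 ≠ 0 := by
    rw [sub_ne_zero]; norm_cast; omega
  have h1 : completeMatrix U = Matrix.of (fun _ _ => (1 : ℂ)) - 1 := by
    ext i j
    by_cases h : i = j <;> simp [completeMatrix, h]
  ext i j
  rw [h1, sub_mul, one_mul]
  simp only [Matrix.sub_apply, mul_apply, of_apply, one_mul, mul_sub, Finset.sum_sub_distrib, Finset.sum_const,
    Finset.card_univ, nsmul_eq_mul, Finset.sum_ite_eq', Finset.mem_univ, if_true, one_apply]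
  split_ifs <;> field_simp <;> ring

theorem det_completeMatrix_ne_zero (h : 2 ≤ Fintype.card U) : (completeMatrix U).det ≠ 0 := by
  intro h0
  have := congrArg Matrix.det (completeMatrix_mul_inverse h)
  rw [det_mul, h0, zero_mul, det_one] at this
  exact zero_ne_one this

end CompleteMatrix

/-- The complete graph matrix with its row and column `v` replaced by `x`. -/
def borderedMatrix {V : Type*} [DecidableEq V] (v : V) (x : V → ℂ) : Matrix V V ℂ :=
  fun i j => if i = j then 0 else if i = v then x j else if j = v then x i else 1

theorem borderedMatrix_symm {V : Type*} [DecidableEq V] (v : V) (x : V → ℂ) (i j : V) :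
    borderedMatrix v x i j = borderedMatrix v x j i := by
  unfold borderedMatrix
  grind

/-- Schur complement of the block `J - 1` on the vertices other than `v`, with its explicit inverse.
The resulting quadratic form in the entries of row `v` is nondegenerate, which `not_both_linear`
exploits. -/
theorem det_borderedMatrix {V : Type*} [DecidableEq V] [Fintype V] (hV : 3 ≤ Fintype.card V)
    (v : V) : ∃ κ : ℂ, κ ≠ 0 ∧ ∀ x : V → ℂ, (borderedMatrix v x).det =
      κ * ((∑ i : {a // ¬ a = v}, x i) ^ 2 -
        ((Fintype.card V : ℂ) - 2) * ∑ i : {a // ¬ a = v}, x i ^ 2) := by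
  have hU : Fintype.card {a // ¬ a = v} = Fintype.card V - 1 := by
    rw [Fintype.card_subtype_compl]; simp
  have hU2 : 2 ≤ Fintype.card {a // ¬ a = v} := by omega
  have hUc : (Fintype.card {a // ¬ a = v} : ℂ) - 1 = Fintype.card V - 2 := by
    rw [hU, Nat.cast_sub (by omega)]; push_cast; ring
  have hc : (Fintype.card V : ℂ) - 2 ≠ 0 := by
    rw [sub_ne_zero]; norm_cast; omega
  refine ⟨-(completeMatrix {a // ¬ a = v}).det / ((Fintype.card V : ℂ) - 2),
    div_ne_zero (neg_ne_zero.mpr (det_completeMatrix_ne_zero hU2)) hc, fun x => ?_⟩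
  have hinv := completeMatrix_mul_inverse hU2
  rw [hUc] at hinv
  let : Invertible (completeMatrix {a // ¬ a = v}) := invertibleOfRightInverse _ _ hinv
  have hD : toBlock (borderedMatrix v x) (fun a => ¬ a = v) (fun a => ¬ a = v) =
      completeMatrix {a // ¬ a = v} := by
    ext i j
    simp [toBlock, borderedMatrix, completeMatrix, i.2, j.2, Subtype.ext_iff]
  let : Fintype {a // a = v} := Subtype.fintype _
  rw [det_toBlock _ (fun a => a = v), hD, det_fromBlocks₂₂,
    det_eq_elem_of_subsingleton (n := {a // a = v}) _ default]
  have h2 : ⅟(completeMatrix {a // ¬ a = v}) = _ := invOf_eq_right_inv hinv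
  rw [h2]
  have hB : ∀ j : {a // ¬ a = v},
      toBlock (borderedMatrix v x) (fun a => a = v) (fun a => ¬ a = v) default j = x j := by
    intro j
    have : (default : {a // a = v}).1 = v := (default : {a // a = v}).2
    simp [toBlock, borderedMatrix, this, Ne.symm j.2]
  have hC : ∀ j : {a // ¬ a = v},
      toBlock (borderedMatrix v x) (fun a => ¬ a = v) (fun a => a = v) j default = x j := by
    intro j
    have : (default : {a // a = v}).1 = v := (default : {a // a = v}).2
    simp [toBlock, borderedMatrix, this, j.2]
  have hA : toBlock (borderedMatrix v x) (fun a => a = v) (fun a => a = v) default default = 0 := by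
    simp [toBlock, borderedMatrix]
  rw [Matrix.sub_apply, hA, mul_apply]
  simp only [mul_apply, of_apply, hB, hC, mul_sub, sub_mul, Finset.sum_sub_distrib, mul_ite, mul_one,
    mul_zero, Finset.sum_ite_eq', Finset.mem_univ, if_true]
  simp only [← Finset.sum_mul, ← Finset.mul_sum]
  field_simp
  ring

/-! ### Irreducibility of the generic symmetric determinant with zero diagonal -/

section Irreducible

variable {V σ : Type*} [DecidableEq V] [Fintype V] (e : σ ≃ {z : Sym2 V // ¬ z.IsDiag})

/-- The determinant of the generic symmetric matrix with zero diagonal. -/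
def edgeDet : MvPolynomial σ ℂ := (edgeMatrix e (MvPolynomial.X (R := ℂ))).det

theorem eval_edgeDet (w : σ → ℂ) :
    MvPolynomial.eval w (edgeDet e) = (edgeMatrix e w).det := eval_det_edgeMatrix e w

theorem eval_edgeDet_edgeWeights (N : Matrix V V ℂ) (hN : ∀ i j, N i j = N j i)
    (h0 : ∀ i, N i i = 0) : MvPolynomial.eval (edgeWeights e N hN) (edgeDet e) = N.det := by
  rw [eval_edgeDet, edgeMatrix_edgeWeights e N hN h0]

theorem edgeDet_ne_zero (hV : 2 ≤ Fintype.card V) : edgeDet e ≠ 0 := by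
  intro h
  have := eval_edgeDet_edgeWeights e (completeMatrix V)
    (fun i j => by simp [completeMatrix, eq_comm]) (by simp [completeMatrix])
  rw [h, map_zero] at this
  exact det_completeMatrix_ne_zero hV this.symm

/-- Scaling the edges at `v` by an indeterminate `X` multiplies the determinant by `X ^ 2`. As `X`
is prime, the images of the two factors are powers of `X` times polynomials whose product is
constant in `X`, hence which are themselves constant in `X`. -/
theorem factor_rowScale (hV : 2 ≤ Fintype.card V) {F G : MvPolynomial σ ℂ}
    (hFG : F * G = edgeDet e) (v : V) : ∃ k l : ℕ, k + l = 2 ∧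
      (∀ t w, MvPolynomial.eval (rowScale e v t w) F = MvPolynomial.eval w F * t ^ k) ∧
      (∀ t w, MvPolynomial.eval (rowScale e v t w) G = MvPolynomial.eval w G * t ^ l) := by
  classical
  let g : σ → Polynomial (MvPolynomial σ ℂ) :=
    rowScale e v Polynomial.X (fun s => Polynomial.C (MvPolynomial.X s))
  let ψ := MvPolynomial.eval₂Hom (Polynomial.C.comp MvPolynomial.C) g
  have hψ : ∀ (p : MvPolynomial σ ℂ) (t : ℂ) (w : σ → ℂ),
      Polynomial.eval₂ (MvPolynomial.eval w) t (ψ p) = MvPolynomial.eval (rowScale e v t w) p := by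
    intro p t w
    have : (Polynomial.eval₂RingHom (MvPolynomial.eval w) t).comp ψ =
        MvPolynomial.eval (rowScale e v t w) := by
      apply MvPolynomial.ringHom_ext
      · intro r; simp [ψ]
      · intro s
        by_cases h : v ∈ (e s).1
        · simp [ψ, g, rowScale, h, mul_comm (w s)]
        · simp [ψ, g, rowScale, h]
    exact congrArg (fun f => f p) this
  have hD : ψ (edgeDet e) = Polynomial.C (edgeDet e) * Polynomial.X ^ 2 := by
    have h1 : (fun s => ψ (MvPolynomial.X s)) = g := by ext1 s; simp [ψ]
    rw [edgeDet, RingHom.map_det, edgeMatrix_map, h1, det_edgeMatrix_rowScale, RingHom.map_det,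
      edgeMatrix_map]
  have hmul : ψ F * ψ G = Polynomial.C (edgeDet e) * Polynomial.X ^ 2 := by
    rw [← map_mul, hFG, hD]
  obtain ⟨k, l, b, c, hkl, hbc, hF, hG⟩ := mul_eq_mul_prime_pow Polynomial.prime_X hmul
  have hdeg := congrArg Polynomial.natDegree hbc
  have hb0 : b ≠ 0 := by
    rintro rfl
    rw [zero_mul, Polynomial.C_eq_zero] at hbc
    exact edgeDet_ne_zero e hV hbc
  have hc0 : c ≠ 0 := by
    rintro rfl
    rw [mul_zero, Polynomial.C_eq_zero] at hbc
    exact edgeDet_ne_zero e hV hbc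
  rw [Polynomial.natDegree_C, Polynomial.natDegree_mul hb0 hc0] at hdeg
  have key : ∀ (p : MvPolynomial σ ℂ) (a : Polynomial (MvPolynomial σ ℂ)) (n : ℕ),
      a.natDegree = 0 → ψ p = a * Polynomial.X ^ n →
      ∀ t w, MvPolynomial.eval (rowScale e v t w) p = MvPolynomial.eval w p * t ^ n := by
    intro p a n ha hp t w
    obtain ⟨a, rfl⟩ := Polynomial.natDegree_eq_zero.mp ha
    -- Scaling by `1` changes nothing, which identifies the constant coefficient as `p` itself.
    have h1 := hψ p 1 w
    have ht := hψ p t w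
    have hw : rowScale e v 1 w = w := by ext s; simp [rowScale]
    rw [hp] at h1 ht
    simp only [Polynomial.eval₂_mul, Polynomial.eval₂_C, Polynomial.eval₂_pow,
      Polynomial.eval₂_X, one_pow, mul_one, hw] at h1 ht
    rw [← ht, h1]
  exact ⟨k, l, hkl, key F b k (by omega) hF, key G c l (by omega) hG⟩

omit [Fintype V] in
theorem edgeWeights_bordered_smul (v : V) (t : ℂ) (x : V → ℂ) :
    edgeWeights e (borderedMatrix v (t • x)) (borderedMatrix_symm v _) =
      rowScale e v t (edgeWeights e (borderedMatrix v x) (borderedMatrix_symm v x)) := by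
  ext s
  simp only [edgeWeights, rowScale]
  have hs := (e s).2
  generalize (e s).1 = z at hs ⊢
  induction z with
  | _ i j =>
    have hij : i ≠ j := by simpa using hs
    simp only [Sym2.lift_mk, Sym2.mem_iff, borderedMatrix, Pi.smul_apply, smul_eq_mul]
    grind

/-- A function that is homogeneous of degree one and differentiable at the origin equals its
derivative there. -/
theorem linear_of_rowScale [Fintype σ] (v : V) {F : MvPolynomial σ ℂ}
    (hF : ∀ t w, MvPolynomial.eval (rowScale e v t w) F = MvPolynomial.eval w F * t) :
    ∃ L : (V → ℂ) →ₗ[ℂ] ℂ, ∀ x,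
      MvPolynomial.eval (edgeWeights e (borderedMatrix v x) (borderedMatrix_symm v x)) F = L x := by
  classical
  set f : (V → ℂ) → ℂ := fun x =>
    MvPolynomial.eval (edgeWeights e (borderedMatrix v x) (borderedMatrix_symm v x)) F with hf
  have hhom : ∀ (t : ℂ) x, f (t • x) = t * f x := by
    intro t x
    simp only [hf]
    rw [edgeWeights_bordered_smul, hF, mul_comm]
  have hdiff : DifferentiableAt ℂ f 0 := by
    have hco : ∀ s, Differentiable ℂ
        fun x => edgeWeights e (borderedMatrix v x) (borderedMatrix_symm v x) s := by
      intro s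
      simp only [edgeWeights]
      generalize (e s).1 = z
      induction z with
      | _ i j =>
        simp only [Sym2.lift_mk, borderedMatrix]
        split_ifs <;> fun_prop
    simp only [hf, MvPolynomial.eval_eq']
    refine DifferentiableAt.fun_sum fun d _ => DifferentiableAt.const_mul ?_ _
    fun_prop
  refine ⟨(fderiv ℂ f 0).toLinearMap, fun x => ?_⟩
  have h1 : HasDerivAt (fun t : ℂ => f (t • x)) (fderiv ℂ f 0 x) 0 := by
    have h2 : HasDerivAt (fun t : ℂ => t • x) x 0 := by
      simpa using (hasDerivAt_id (0 : ℂ)).smul_const x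
    have h3 : HasFDerivAt f (fderiv ℂ f 0) ((0 : ℂ) • x) := by
      rw [zero_smul]; exact hdiff.hasFDerivAt
    exact h3.comp_hasDerivAt 0 h2
  have h2 : HasDerivAt (fun t : ℂ => f (t • x)) (f x) 0 := by
    simp only [hhom]
    simpa using (hasDerivAt_id (0 : ℂ)).mul_const (f x)
  exact h2.unique h1

/-- A common zero of the two linear forms lies in the radical of their product, here a nondegenerate
quadratic form. -/
theorem not_both_linear [Fintype σ] (hV : 4 ≤ Fintype.card V) {F G : MvPolynomial σ ℂ}
    (hFG : F * G = edgeDet e) (v : V)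
    (hF : ∀ t w, MvPolynomial.eval (rowScale e v t w) F = MvPolynomial.eval w F * t)
    (hG : ∀ t w, MvPolynomial.eval (rowScale e v t w) G = MvPolynomial.eval w G * t) : False := by
  obtain ⟨f, hf⟩ := linear_of_rowScale e v hF
  obtain ⟨g, hg⟩ := linear_of_rowScale e v hG
  obtain ⟨κ, hκ, hq⟩ := det_borderedMatrix (by omega : 3 ≤ Fintype.card V) v
  have hmul : ∀ x, (borderedMatrix v x).det = f x * g x := by
    intro x
    rw [← hf, ← hg, ← map_mul, hFG, eval_edgeDet_edgeWeights]
    simp [borderedMatrix]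
  -- The form does not involve the coordinate at `v`, so that coordinate is set to zero as well.
  -- Three conditions on at least four coordinates leave a nonzero solution.
  let T : (V → ℂ) →ₗ[ℂ] (Fin 3 → ℂ) := LinearMap.pi ![f, g, LinearMap.proj v]
  obtain ⟨x, hx, hx0⟩ : ∃ x ∈ LinearMap.ker T, x ≠ 0 := by
    apply Submodule.exists_mem_ne_zero_of_ne_bot
    apply LinearMap.ker_ne_bot_of_finrank_lt
    simp; omega
  have hTx := LinearMap.mem_ker.mp hx
  have hfx : f x = 0 := congrFun hTx 0
  have hgx : g x = 0 := congrFun hTx 1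
  have hvx : x v = 0 := congrFun hTx 2
  set n : ℂ := (Fintype.card V : ℂ) with hn_def
  set S := ∑ i : {a // ¬ a = v}, x i with hS
  -- Orthogonality of `x` to the `j`-th unit vector, read off by polarization.
  have hpolar : ∀ j : {a // ¬ a = v}, S = (n - 2) * x j := by
    intro j
    have h1 := hmul (x + Pi.single j.1 1)
    have h2 := hmul x
    have h3 := hmul (Pi.single j.1 1)
    have hs : ∀ i : {a // ¬ a = v}, (Pi.single j.1 1 : V → ℂ) i = if i = j then 1 else 0 := by
      intro i; simp [Pi.single_apply, Subtype.ext_iff]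
    rw [map_add, map_add, hfx, hgx, zero_add, zero_add, ← h3] at h1
    rw [hfx, zero_mul] at h2
    rw [hq] at h1 h2 h3
    rw [hq] at h1
    simp only [Pi.add_apply, add_sq, Finset.sum_add_distrib, hs, mul_ite, mul_one,
      mul_zero, ite_pow, one_pow, Finset.sum_ite_eq', Finset.mem_univ, if_true, ne_eq,
      OfNat.ofNat_ne_zero, not_false_eq_true, zero_pow] at h1 h2
    rw [← hS] at h1 h2
    have h4 : κ * (S - (n - 2) * x j) = 0 := by linear_combination (h1 - h2) / 2
    rcases mul_eq_zero.mp h4 with h | h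
    · exact absurd h hκ
    · exact sub_eq_zero.mp h
  have hcard : (Fintype.card {a // ¬ a = v} : ℂ) = n - 1 := by
    have : Fintype.card {a // ¬ a = v} = Fintype.card V - 1 := by
      rw [Fintype.card_subtype_compl]; simp
    rw [this, Nat.cast_sub (by omega)]; simp [n]
  have hS0 : S = 0 := by
    -- Sum the relations `hpolar` over the `n - 1` indices different from `v`.
    have h1 : (n - 1) * S = (n - 2) * S := by
      conv_rhs => rw [hS, Finset.mul_sum]
      rw [← Finset.sum_congr rfl fun j _ => hpolar j]
      rw [Finset.sum_const, Finset.card_univ, nsmul_eq_mul, hcard]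
    linear_combination h1
  have hn : n - 2 ≠ 0 := by
    rw [sub_ne_zero]; simp only [hn_def]; norm_cast; omega
  apply hx0
  ext a
  by_cases ha : a = v
  · rw [ha, hvx]; rfl
  · have := hpolar ⟨a, ha⟩
    rw [hS0] at this
    simpa [hn] using this.symm

/-- The vertices are switched off one after another; each edge has an endpoint, so in the end all
weights are zero. -/
theorem eval_eq_eval_zero {F : MvPolynomial σ ℂ}
    (hF : ∀ v w, MvPolynomial.eval (rowScale e v 0 w) F = MvPolynomial.eval w F) (w : σ → ℂ) :
    MvPolynomial.eval w F = MvPolynomial.eval 0 F := by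
  classical
  have h : ∀ (A : Finset V), MvPolynomial.eval (fun s => if ∃ v ∈ A, v ∈ (e s).1 then 0 else w s) F =
      MvPolynomial.eval w F := by
    intro A
    induction A using Finset.induction with
    | empty => simp
    | insert v A _ ih =>
      rw [← ih, ← hF v (fun s => if ∃ v ∈ A, v ∈ (e s).1 then 0 else w s)]
      congr 2
      ext s
      simp only [rowScale, Finset.exists_mem_insert]
      grind
  rw [← h Finset.univ]
  congr 2
  ext s
  have : ∃ v, v ∈ (e s).1 := by
    induction (e s).1 with
    | _ i j => exact ⟨i, by simp⟩
  simp [this]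

theorem isUnit_of_eval_rowScale {F : MvPolynomial σ ℂ} (hF0 : F ≠ 0)
    (hF : ∀ v w, MvPolynomial.eval (rowScale e v 0 w) F = MvPolynomial.eval w F) : IsUnit F := by
  have h : F = MvPolynomial.C (MvPolynomial.eval 0 F) := by
    apply MvPolynomial.funext
    intro w
    rw [eval_eq_eval_zero e hF w, MvPolynomial.eval_C]
  rw [h] at hF0 ⊢
  refine IsUnit.map _ (isUnit_iff_ne_zero.mpr fun h0 => hF0 (by rw [h0, map_zero]))

/-- The disjoint union of an edge `uv` of weight `t` and a complete graph on the other vertices. -/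
def edgeAndComplete (u v : V) (t : ℂ) : Matrix V V ℂ :=
  fun i j => if i = j then 0 else if i = u then (if j = v then t else 0)
    else if i = v then (if j = u then t else 0) else if j = u ∨ j = v then 0 else 1

omit [Fintype V] in
theorem edgeAndComplete_symm (u v : V) (t : ℂ) (i j : V) :
    edgeAndComplete u v t i j = edgeAndComplete u v t j i := by
  unfold edgeAndComplete
  grind

theorem det_edgeAndComplete_zero (u v : V) : (edgeAndComplete u v 0).det = 0 :=
  det_eq_zero_of_row_eq_zero u fun j => by simp [edgeAndComplete]

/-- In a kernel vector, rows `u` and `v` kill the entries at `v` and `u`. Every other entry equals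
the total sum `S`, so `S = (n - 2) S` with `n ≥ 4` vertices, and `S = 0`. -/
theorem det_edgeAndComplete_one (hV : 4 ≤ Fintype.card V) {u v : V} (huv : u ≠ v) :
    (edgeAndComplete u v 1).det ≠ 0 := by
  intro h
  obtain ⟨x, hx0, hx⟩ := exists_mulVec_eq_zero_iff.mpr h
  apply hx0
  have hrow : ∀ i, ∑ j, edgeAndComplete u v 1 i j * x j = 0 := fun i => congrFun hx i
  have hv : x v = 0 := by
    have := hrow u
    rwa [Finset.sum_eq_single v (by intro b _ hb; simp [edgeAndComplete, hb]) (by simp),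
      show edgeAndComplete u v 1 u v = 1 by simp [edgeAndComplete, huv], one_mul] at this
  have hu : x u = 0 := by
    have := hrow v
    rwa [Finset.sum_eq_single u (by intro b _ hb; simp [edgeAndComplete, hb, huv.symm]) (by simp),
      show edgeAndComplete u v 1 v u = 1 by simp [edgeAndComplete, huv.symm], one_mul] at this
  have hi : ∀ i, i ≠ u → i ≠ v → x i = ∑ j, x j := by
    intro i hiu hiv
    have h1 := hrow i
    have h2 : ∀ j, edgeAndComplete u v 1 i j * x j = x j - if j = i then x i else 0 := by
      intro j
      simp only [edgeAndComplete]
      grind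
    simp only [h2, Finset.sum_sub_distrib, Finset.sum_ite_eq', Finset.mem_univ, if_true] at h1
    linear_combination -h1
  have hS : ∑ j, x j = ((Fintype.card V : ℂ) - 2) * ∑ j, x j := by
    have h2 : ∀ j, x j = (∑ k, x k) - (if j = u then ∑ k, x k else 0) -
        (if j = v then ∑ k, x k else 0) := by
      intro j
      by_cases hju : j = u
      · subst hju; simp [hu, huv]
      · by_cases hjv : j = v
        · subst hjv; simp [hv, hju]
        · simp [hju, hjv, hi j hju hjv]
    conv_lhs => rw [Finset.sum_congr rfl fun j _ => h2 j]
    simp only [Finset.sum_sub_distrib, Finset.sum_ite_eq', Finset.mem_univ, if_true,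
      Finset.sum_const, Finset.card_univ, nsmul_eq_mul]
    ring
  have hS0 : ∑ j, x j = 0 := by
    have h3 : ((Fintype.card V : ℂ) - 3) * ∑ j, x j = 0 := by linear_combination -hS
    rcases mul_eq_zero.mp h3 with h | h
    · rw [sub_eq_zero] at h
      have : Fintype.card V = 3 := by exact_mod_cast h
      omega
    · exact h
  ext i
  by_cases hiu : i = u
  · rw [hiu, hu]; rfl
  · by_cases hiv : i = v
    · rw [hiv, hv]; rfl
    · rw [hi i hiu hiv, hS0]; rfl

-- The two matrices differ only in the weight of the edge `uv`, and switching off either endpoint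
-- erases it.
omit [Fintype V] in
theorem rowScale_zero_edgeAndComplete {u v a : V} (ha : a = u ∨ a = v) (t : ℂ) :
    rowScale e a 0 (edgeWeights e (edgeAndComplete u v t) (edgeAndComplete_symm u v t)) =
      rowScale e a 0 (edgeWeights e (edgeAndComplete u v 0) (edgeAndComplete_symm u v 0)) := by
  ext s
  simp only [edgeWeights, rowScale]
  induction (e s).1 with
  | _ i j =>
    simp only [Sym2.lift_mk, Sym2.mem_iff, edgeAndComplete]
    grind

theorem irreducible_edgeDet [Fintype σ] (hV : 4 ≤ Fintype.card V) : Irreducible (edgeDet e) := by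
  have hne := edgeDet_ne_zero e (by omega)
  have : Nonempty V := Fintype.card_pos_iff.mp (by omega)
  constructor
  · intro h
    have h1 := h.map (MvPolynomial.eval (0 : σ → ℂ))
    rw [eval_edgeDet] at h1
    refine h1.ne_zero (det_eq_zero_of_row_eq_zero (Classical.arbitrary V) fun j => ?_)
    simp [edgeMatrix]
  intro F G hFG
  replace hFG := hFG.symm
  have hF0 : F ≠ 0 := by rintro rfl; exact hne (by rw [← hFG, zero_mul])
  have hG0 : G ≠ 0 := by rintro rfl; exact hne (by rw [← hFG, mul_zero])
  choose k l hkl hk hl using factor_rowScale e (by omega) hFG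
  have h11 : ∀ v, k v ≠ 1 := by
    intro v h1
    have h2 : l v = 1 := by have := hkl v; omega
    refine not_both_linear e hV hFG v (fun t w => ?_) fun t w => ?_
    · rw [hk, h1, pow_one]
    · rw [hl, h2, pow_one]
  by_cases hkz : ∀ v, k v = 0
  · exact Or.inl (isUnit_of_eval_rowScale e hF0 fun v w => by rw [hk, hkz, pow_zero, mul_one])
  by_cases hlz : ∀ v, l v = 0
  · exact Or.inr (isUnit_of_eval_rowScale e hG0 fun v w => by rw [hl, hlz, pow_zero, mul_one])
  push Not at hkz hlz
  obtain ⟨u, hu⟩ := hkz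
  obtain ⟨v, hv⟩ := hlz
  have hlu : l u = 0 := by have := hkl u; have := h11 u; omega
  have hkv : k v = 0 := by have := hkl v; have := h11 v; omega
  have huv : u ≠ v := by rintro rfl; exact hv hlu
  exfalso
  -- `F` has degree zero at `v` and `G` has degree zero at `u`, so each takes the same value whether
  -- `uv` has weight `1` or `0`. The product would give equal determinants, but only the second one
  -- vanishes.
  have hF := hk v 0 (edgeWeights e (edgeAndComplete u v 1) (edgeAndComplete_symm u v 1))
  have hG := hl u 0 (edgeWeights e (edgeAndComplete u v 1) (edgeAndComplete_symm u v 1))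
  rw [rowScale_zero_edgeAndComplete e (Or.inr rfl), hk, hkv, pow_zero, mul_one, mul_one] at hF
  rw [rowScale_zero_edgeAndComplete e (Or.inl rfl), hl, hlu, pow_zero, mul_one, mul_one] at hG
  apply det_edgeAndComplete_one hV huv
  rw [← eval_edgeDet_edgeWeights e _ (edgeAndComplete_symm u v 1) (by simp [edgeAndComplete]),
    ← hFG, map_mul, ← hF, ← hG, ← map_mul, hFG, eval_edgeDet_edgeWeights e _ _
      (by simp [edgeAndComplete]), det_edgeAndComplete_zero]

end Irreducible

/-! ### The vanishing ideal of the matrices with a kernel vector in the torus -/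

section VanishingIdeal

variable {V σ : Type} [DecidableEq V] [Fintype V] (e : σ ≃ {z : Sym2 V // ¬ z.IsDiag})

/-- The nonzero weights whose matrix has a kernel vector without zero entries. -/
def torusKernel : Set (σ → ℂ) :=
  {w | (∀ s, w s ≠ 0) ∧ ∃ θ : V → ℂ, (∀ i, θ i ≠ 0) ∧ edgeMatrix e w *ᵥ θ = 0}

/-- The principal minor of the generic matrix that omits the row and column `i`. -/
def edgeMinor (i : V) : MvPolynomial σ ℂ :=
  ((edgeMatrix e (MvPolynomial.X (R := ℂ))).submatrix
    (Subtype.val : {a // ¬ a = i} → V) Subtype.val).det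

theorem eval_edgeMinor (i : V) (w : σ → ℂ) : MvPolynomial.eval w (edgeMinor e i) =
    ((edgeMatrix e w).submatrix (Subtype.val : {a // ¬ a = i} → V) Subtype.val).det := by
  have h := edgeMatrix_map e (MvPolynomial.eval w) (MvPolynomial.X (R := ℂ))
  simp only [MvPolynomial.eval_X] at h
  rw [edgeMinor, RingHom.map_det, ← h]
  rfl

/-- Make `i` an isolated vertex in an otherwise complete graph: the determinant vanishes but the
minor does not. -/
theorem not_edgeDet_dvd_edgeMinor (hV : 3 ≤ Fintype.card V) (i : V) :
    ¬ edgeDet e ∣ edgeMinor e i := by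
  rintro ⟨q, hq⟩
  have hs := borderedMatrix_symm i (0 : V → ℂ)
  have h0 : ∀ j, borderedMatrix i (0 : V → ℂ) j j = 0 := by simp [borderedMatrix]
  have h := congrArg (MvPolynomial.eval (edgeWeights e (borderedMatrix i 0) hs)) hq
  rw [map_mul, eval_edgeDet_edgeWeights e _ hs h0, eval_edgeMinor,
    edgeMatrix_edgeWeights e _ hs h0,
    det_eq_zero_of_row_eq_zero (A := borderedMatrix i (0 : V → ℂ)) i
      (fun j => by simp [borderedMatrix]), zero_mul] at h
  have hD : (borderedMatrix i (0 : V → ℂ)).submatrix (Subtype.val : {a // ¬ a = i} → V)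
      Subtype.val = completeMatrix {a // ¬ a = i} := by
    ext a b
    simp [borderedMatrix, completeMatrix, a.2, b.2, Subtype.ext_iff]
  rw [hD] at h
  refine det_completeMatrix_ne_zero ?_ h
  rw [Fintype.card_subtype_compl]
  simp
  omega

/-- With `s` as the only edge of nonzero weight, a third vertex has a zero row. -/
theorem not_edgeDet_dvd_X (hV : 3 ≤ Fintype.card V) (s : σ) :
    ¬ edgeDet e ∣ (MvPolynomial.X s : MvPolynomial σ ℂ) := by
  classical
  rintro ⟨q, hq⟩
  have h := congrArg (MvPolynomial.eval (Pi.single s 1)) hq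
  rw [MvPolynomial.eval_X, Pi.single_eq_same, map_mul, eval_edgeDet] at h
  obtain ⟨k, hk⟩ : ∃ k : V, k ∉ (e s).1 := by
    induction (e s).1 with
    | _ i j =>
      by_contra! hall
      have : Finset.univ ⊆ ({i, j} : Finset V) := fun k _ => by simpa using hall k
      have := Finset.card_le_card this
      have := Finset.card_le_two (a := i) (b := j)
      rw [Finset.card_univ] at *
      omega
  rw [det_eq_zero_of_row_eq_zero k, zero_mul] at h
  · exact one_ne_zero h
  intro j
  by_cases hkj : k = j
  · simp [edgeMatrix, hkj]
  · simp only [edgeMatrix, hkj, dite_false]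
    apply Pi.single_eq_of_ne
    rintro rfl
    simp at hk

theorem edgeDet_mem_vanishingIdeal [Nonempty V] :
    edgeDet e ∈ MvPolynomial.vanishingIdeal ℂ (torusKernel e) := by
  rintro w ⟨-, θ, hθ, hw⟩
  change MvPolynomial.eval w (edgeDet e) = 0
  rw [eval_edgeDet]
  refine exists_mulVec_eq_zero_iff.mp ⟨θ, fun h => ?_, hw⟩
  exact hθ (Classical.arbitrary V) (by rw [h]; rfl)

/-- If a kernel vector vanishes at `i`, deleting that entry leaves a nonzero kernel vector of the
principal submatrix without `i`. -/
theorem mem_torusKernel_of_det_eq_zero {w : σ → ℂ} (hw : ∀ s, w s ≠ 0)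
    (hdet : (edgeMatrix e w).det = 0)
    (hminor : ∀ i, MvPolynomial.eval w (edgeMinor e i) ≠ 0) : w ∈ torusKernel e := by
  obtain ⟨θ, hθ0, hθ⟩ := exists_mulVec_eq_zero_iff.mpr hdet
  refine ⟨hw, θ, fun i hi => ?_, hθ⟩
  apply hminor i
  rw [eval_edgeMinor]
  refine exists_mulVec_eq_zero_iff.mp ⟨fun a => θ a.1, fun h => hθ0 ?_, ?_⟩
  · ext a
    by_cases ha : a = i
    · rw [ha, hi]; rfl
    · exact congrFun h ⟨a, ha⟩
  · ext a
    have h := congrFun hθ a.1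
    simp only [mulVec, dotProduct, Pi.zero_apply, submatrix_apply] at h ⊢
    rw [← h, ← Fintype.sum_subtype_add_sum_subtype (fun b => ¬ b = i)
      (fun b => edgeMatrix e w a.1 b * θ b), left_eq_add]
    refine Finset.sum_eq_zero fun b _ => ?_
    rw [not_not.mp b.2, hi, mul_zero]

theorem vanishingIdeal_torusKernel [Fintype σ] (hV : 4 ≤ Fintype.card V) :
    MvPolynomial.vanishingIdeal ℂ (torusKernel e) = Ideal.span {edgeDet e} := by
  have : Nonempty V := Fintype.card_pos_iff.mp (by omega)
  have hprime : Prime (edgeDet e) := (irreducible_edgeDet e hV).prime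
  apply le_antisymm
  · intro p hp
    rw [Ideal.mem_span_singleton]
    -- The extra factors vanish wherever a zero of the determinant may fail to lie in `torusKernel
    -- e`, so the product vanishes on the whole hypersurface.
    have hq : p * ((∏ s, MvPolynomial.X s) * ∏ i, edgeMinor e i) ∈
        MvPolynomial.vanishingIdeal ℂ (MvPolynomial.zeroLocus ℂ (Ideal.span {edgeDet e})) := by
      intro w hw
      have hdet : (edgeMatrix e w).det = 0 := by
        rw [← eval_edgeDet]
        exact hw _ (Ideal.mem_span_singleton_self _)
      rw [map_mul, map_mul, map_prod, map_prod]
      by_contra hne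
      have h1 := right_ne_zero_of_mul hne
      apply left_ne_zero_of_mul hne
      apply hp
      refine mem_torusKernel_of_det_eq_zero e (fun s => ?_) hdet fun i => ?_
      · simpa using Finset.prod_ne_zero_iff.mp (left_ne_zero_of_mul h1) s (Finset.mem_univ s)
      · exact Finset.prod_ne_zero_iff.mp (right_ne_zero_of_mul h1) i (Finset.mem_univ i)
    rw [MvPolynomial.vanishingIdeal_zeroLocus_eq_radical, (Ideal.IsPrime.radical
      ((Ideal.span_singleton_prime hprime.ne_zero).mpr hprime)), Ideal.mem_span_singleton] at hq
    rcases hprime.dvd_or_dvd hq with h | h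
    · exact h
    rcases hprime.dvd_or_dvd h with h | h
    · obtain ⟨s, -, hs⟩ := (Prime.dvd_finsetProd_iff hprime _).mp h
      exact absurd hs (not_edgeDet_dvd_X e (by omega) s)
    · obtain ⟨i, -, hi⟩ := (Prime.dvd_finsetProd_iff hprime _).mp h
      exact absurd hi (not_edgeDet_dvd_edgeMinor e (by omega) i)
  · rw [Ideal.span_singleton_le_iff_mem]
    exact edgeDet_mem_vanishingIdeal e

/-- Krull's principal ideal theorem gives the upper bound; in a domain only the zero ideal has
height zero among primes. -/
theorem Ideal.height_span_singleton_of_prime {R : Type*} [CommRing R] [IsDomain R]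
    [IsNoetherianRing R] {p : R} (hp : Prime p) : (Ideal.span {p}).height = 1 := by
  have hP : (Ideal.span {p}).IsPrime := (Ideal.span_singleton_prime hp.ne_zero).mpr hp
  refine le_antisymm (Ideal.height_le_one_of_isPrincipal_of_mem_minimalPrimes (Ideal.span {p}) _ ?_) ?_
  · rw [Ideal.minimalPrimes_eq_subsingleton_self]
    exact Set.mem_singleton _
  · rw [Order.one_le_iff_ne_zero, Ne, Ideal.height_eq_zero_iff_eq_bot, Ideal.span_singleton_eq_bot]
    exact hp.ne_zero

end VanishingIdeal

/-! ### The `A`-discriminant from the vanishing ideal -/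

section Discriminant

variable {ι : Type} [Fintype ι] {d : ℕ} (A : ι → Fin d → ℤ)

theorem vanishingIdeal_discriminantLocus :
    MvPolynomial.vanishingIdeal ℂ (discriminantLocus A) =
      MvPolynomial.vanishingIdeal ℂ (singularScalings A) := by
  apply le_antisymm
  · exact MvPolynomial.vanishingIdeal_anti_mono fun w hw =>
      ⟨hw.1, MvPolynomial.zeroLocus_vanishingIdeal_le _ hw⟩
  · intro p hp w hw
    exact hw.2 p hp

/-- Whichever polynomial is chosen, it lies in the ideal of `D`, and an irreducible multiple of `D`
is associated to `D`. -/
theorem aDiscriminant_associated {D : MvPolynomial ι ℂ} (hD : Irreducible D)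
    (h : MvPolynomial.vanishingIdeal ℂ (singularScalings A) = Ideal.span {D}) :
    Associated (aDiscriminant A) D := by
  have hex : ∃ Δ, IsADiscriminant A Δ := by
    refine ⟨D, ?_, hD, fun w hw => ?_⟩
    · rw [vanishingIdeal_discriminantLocus, h]
      exact Ideal.height_span_singleton_of_prime hD.prime
    · have : D ∈ MvPolynomial.vanishingIdeal ℂ (discriminantLocus A) := by
        rw [vanishingIdeal_discriminantLocus, h]
        exact Ideal.mem_span_singleton_self D
      exact this w hw
  rw [aDiscriminant, dif_pos hex]
  obtain ⟨-, hirr, hvan⟩ := hex.choose_spec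
  have hmem : hex.choose ∈ MvPolynomial.vanishingIdeal ℂ (discriminantLocus A) := hvan
  rw [vanishingIdeal_discriminantLocus, h, Ideal.mem_span_singleton] at hmem
  exact (hD.associated_of_dvd hirr hmem).symm

theorem aDiscriminant_eq_one (h : singularScalings A = ∅) : aDiscriminant A = 1 := by
  rw [aDiscriminant, dif_neg]
  rintro ⟨Δ, h1, -⟩
  rw [vanishingIdeal_discriminantLocus, h, MvPolynomial.vanishingIdeal_empty,
    Ideal.height_top] at h1
  exact ENat.top_ne_one h1

/-- Multiplying by `θ k` undoes the exponent shift of the derivative, so the equations become linear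
in the monomials of `f_w`. -/
theorem deriv_laurentSum (w : ι → ℂ) (θ : Fin d → ℂ) (k : Fin d) (hθ : ∀ k, θ k ≠ 0) :
    θ k * deriv (fun t : ℂ => laurentSum A w (Function.update θ k t)) (θ k) =
      ∑ i, A i k * (w i * ∏ j, θ j ^ A i j) := by
  have h : ∀ i, HasDerivAt (fun t : ℂ => w i * ∏ j, Function.update θ k t j ^ A i j)
      (w i * ((A i k * θ k ^ (A i k - 1)) * ∏ j ∈ Finset.univ.erase k, θ j ^ A i j)) (θ k) := by
    intro i
    refine HasDerivAt.const_mul _ ?_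
    have h1 : (fun t : ℂ => ∏ j, Function.update θ k t j ^ A i j) =
        fun t => t ^ A i k * ∏ j ∈ Finset.univ.erase k, θ j ^ A i j := by
      ext t
      rw [← Finset.mul_prod_erase _ _ (Finset.mem_univ k), Function.update_self]
      congr 1
      refine Finset.prod_congr rfl fun j hj => ?_
      rw [Function.update_of_ne (Finset.ne_of_mem_erase hj)]
    rw [h1]
    exact (hasDerivAt_zpow _ _ (Or.inl (hθ k))).mul_const _
  unfold laurentSum
  rw [(HasDerivAt.fun_sum fun i _ => h i).deriv, Finset.mul_sum]
  refine Finset.sum_congr rfl fun i _ => ?_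
  rw [← Finset.mul_prod_erase Finset.univ (fun j => θ j ^ A i j) (Finset.mem_univ k),
    zpow_sub_one₀ (hθ k)]
  field_simp [hθ k]

end Discriminant

/-! ### Singular hypersurfaces for sets of columns of the second hypersimplex -/

section Columns

variable {d : ℕ}

theorem hypersimplexColumns_apply (p : Pairs d) (k : Fin d) :
    hypersimplexColumns d p k = (if k = p.1.1 then 1 else 0) + if k = p.1.2 then 1 else 0 := by
  simp [hypersimplexColumns, Pi.single_apply]

theorem prod_zpow_hypersimplexColumns (p : Pairs d) (θ : Fin d → ℂ) (hθ : ∀ k, θ k ≠ 0) :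
    ∏ k, θ k ^ hypersimplexColumns d p k = θ p.1.1 * θ p.1.2 := by
  simp only [hypersimplexColumns_apply, zpow_add₀ (hθ _), Finset.prod_mul_distrib]
  congr 1
  · rw [Finset.prod_eq_single p.1.1 (by intro b _ hb; simp [hb]) (by simp)]; simp
  · rw [Finset.prod_eq_single p.1.2 (by intro b _ hb; simp [hb]) (by simp)]; simp

/-- Each column has coordinate sum `2`, so the weighted derivatives add up to `2 f_w` and the
equation `f_w = 0` is redundant. -/
theorem mem_singularScalings_hypersimplex (C : Finset (Pairs d)) (w : C → ℂ) :
    w ∈ singularScalings (fun p : C => hypersimplexColumns d p) ↔ (∀ p, w p ≠ 0) ∧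
      ∃ θ : Fin d → ℂ, (∀ k, θ k ≠ 0) ∧ ∀ k, ∑ p : C, (hypersimplexColumns d p k : ℂ) *
        (w p * (θ p.1.1.1 * θ p.1.1.2)) = 0 := by
  refine and_congr_right fun _ => exists_congr fun θ => and_congr_right fun hθ => ?_
  have hd : ∀ k, deriv (fun t : ℂ => laurentSum (fun p : C => hypersimplexColumns d p) w
      (Function.update θ k t)) (θ k) = 0 ↔ ∑ p : C, (hypersimplexColumns d p k : ℂ) *
        (w p * (θ p.1.1.1 * θ p.1.1.2)) = 0 := by
    intro k
    have h := deriv_laurentSum (fun p : C => hypersimplexColumns d p) w θ k hθ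
    simp only [prod_zpow_hypersimplexColumns _ θ hθ] at h
    rw [← h, mul_eq_zero, or_iff_right (hθ k)]
  simp only [hd]
  refine ⟨fun h => h.2, fun h => ⟨?_, h⟩⟩
  have hsum : ∑ k, ∑ p : C, (hypersimplexColumns d p k : ℂ) *
        (w p * (θ p.1.1.1 * θ p.1.1.2)) = 0 := Finset.sum_eq_zero fun k _ => h k
  rw [Finset.sum_comm] at hsum
  have h2 : ∀ p : C, ∑ k, (hypersimplexColumns d p k : ℂ) = 2 := by
    intro p
    simp only [hypersimplexColumns_apply]
    push_cast
    rw [Finset.sum_add_distrib]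
    simp
    norm_num
  simp only [← Finset.sum_mul, h2, ← Finset.mul_sum] at hsum
  simp only [laurentSum, prod_zpow_hypersimplexColumns _ θ hθ]
  simpa using hsum

/-- At a vertex `k` of degree one, the `k`-th equation says that a single monomial vanishes, which
is impossible in the torus. -/
theorem singularScalings_eq_empty_of_unique (C : Finset (Pairs d)) (k : Fin d) (p : Pairs d)
    (hp : p ∈ C) (hk : k = p.1.1 ∨ k = p.1.2)
    (huniq : ∀ q ∈ C, k = q.1.1 ∨ k = q.1.2 → q = p) :
    singularScalings (fun p : C => hypersimplexColumns d p) = ∅ := by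
  rw [Set.eq_empty_iff_forall_notMem]
  intro w hw
  obtain ⟨hw0, θ, hθ, h⟩ := (mem_singularScalings_hypersimplex C w).mp hw
  have h1 := h k
  rw [Finset.sum_eq_single ⟨p, hp⟩] at h1
  · have hA : hypersimplexColumns d p k = 1 := by
      have := p.2.ne
      rw [hypersimplexColumns_apply]
      rcases hk with rfl | rfl
      · simp [this]
      · simp [this.symm]
    simp [hA, hw0, hθ] at h1
  · intro q _ hq
    have : ¬ (k = q.1.1.1 ∨ k = q.1.1.2) := fun h => hq (Subtype.ext (huniq q.1 q.2 h))
    push Not at this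
    simp [hypersimplexColumns_apply, this.1, this.2]
  · simp

theorem singularScalings_eq_empty_of_triangle (C : Finset (Pairs d)) {i j k : Fin d} (hij : i < j)
    (hjk : j < k) (hC : ∀ p, p ∈ C ↔ p = ⟨(i, j), hij⟩ ∨ p = ⟨(i, k), hij.trans hjk⟩ ∨
      p = ⟨(j, k), hjk⟩) :
    singularScalings (fun p : C => hypersimplexColumns d p) = ∅ := by
  rw [Set.eq_empty_iff_forall_notMem]
  intro w hw
  obtain ⟨hw0, θ, hθ, h⟩ := (mem_singularScalings_hypersimplex C w).mp hw
  let a : C := ⟨⟨(i, j), hij⟩, (hC _).mpr (Or.inl rfl)⟩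
  let b : C := ⟨⟨(i, k), hij.trans hjk⟩, (hC _).mpr (Or.inr (Or.inl rfl))⟩
  let c : C := ⟨⟨(j, k), hjk⟩, (hC _).mpr (Or.inr (Or.inr rfl))⟩
  have hab : a ≠ b := by simp [a, b, hjk.ne]
  have hac : a ≠ c := by simp [a, c, hij.ne]
  have hbc : b ≠ c := by simp [b, c, hij.ne]
  have huniv : (Finset.univ : Finset C) = {a, b, c} := by
    ext x
    simp only [Finset.mem_univ, Finset.mem_insert, Finset.mem_singleton, true_iff]
    simpa [a, b, c, Subtype.ext_iff] using (hC x.1).mp x.2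
  have h3 : ∀ f : C → ℂ, ∑ x, f x = f a + f b + f c := by
    intro f
    rw [huniv, Finset.sum_insert (by simp [hab, hac]), Finset.sum_pair hbc, add_assoc]
  have hi := h i
  have hj := h j
  have hk := h k
  simp only [h3, hypersimplexColumns_apply, a, b, c, hij.ne, hjk.ne, hij.ne', hjk.ne',
    (hij.trans hjk).ne, (hij.trans hjk).ne'] at hi hj hk
  have : w a * (θ i * θ j) = 0 := by
    simp only [a]
    simp at hi hj hk
    -- The vertex-edge incidence matrix of a triangle is invertible; this is the row of its inverse
    -- for the edge `ij`.
    linear_combination (hi + hj - hk) / 2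
  simp [hw0, hθ] at this

/-- The pairs in `E`, as the edges of the complete graph on `E`. -/
def pairsEquiv (C : Finset (Pairs d)) (E : Finset (Fin d))
    (hC : ∀ p, p ∈ C ↔ p.1.1 ∈ E ∧ p.1.2 ∈ E) : C ≃ {z : Sym2 E // ¬ z.IsDiag} :=
  Equiv.ofBijective (fun p => ⟨s(⟨p.1.1.1, ((hC p.1).mp p.2).1⟩, ⟨p.1.1.2, ((hC p.1).mp p.2).2⟩), by
    simpa using p.1.2.ne⟩) (by
    constructor
    · rintro ⟨⟨⟨a, b⟩, hab⟩, hp⟩ ⟨⟨⟨a', b'⟩, hab'⟩, hp'⟩ h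
      simp only [Subtype.mk.injEq, Sym2.eq_iff] at h
      simp only at hab hab'
      simp only [Subtype.mk.injEq, Prod.mk.injEq]
      omega
    · rintro ⟨z, hz⟩
      induction z with
      | _ i j =>
        have hij : i ≠ j := by simpa using hz
        rcases lt_or_gt_of_ne hij with h | h
        · exact ⟨⟨⟨(i.1, j.1), h⟩, (hC _).mpr ⟨i.2, j.2⟩⟩, rfl⟩
        · exact ⟨⟨⟨(j.1, i.1), h⟩, (hC _).mpr ⟨j.2, i.2⟩⟩, Subtype.ext Sym2.eq_swap⟩)

variable (C : Finset (Pairs d)) (E : Finset (Fin d))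

theorem mem_pairsEquiv (hC : ∀ p, p ∈ C ↔ p.1.1 ∈ E ∧ p.1.2 ∈ E) (p : C) (k : E) :
    k ∈ (pairsEquiv C E hC p).1 ↔ k.1 = p.1.1.1 ∨ k.1 = p.1.1.2 := by
  change k ∈ s(_, _) ↔ _
  rw [Sym2.mem_iff, Subtype.ext_iff, Subtype.ext_iff]

theorem pairsEquiv_symm_of_lt (hC : ∀ p, p ∈ C ↔ p.1.1 ∈ E ∧ p.1.2 ∈ E) {i j : E} (h : i < j) (hd : ¬ s(i, j).IsDiag) :
    (pairsEquiv C E hC).symm ⟨s(i, j), hd⟩ = ⟨⟨(i.1, j.1), h⟩, (hC _).mpr ⟨i.2, j.2⟩⟩ := by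
  rw [Equiv.symm_apply_eq]
  rfl

/-- Only edges through `k` contribute, and they correspond to their other endpoints `j`. -/
theorem sum_hypersimplexColumns (hC : ∀ p, p ∈ C ↔ p.1.1 ∈ E ∧ p.1.2 ∈ E) (w : C → ℂ) (θ : Fin d → ℂ) (k : E) :
    ∑ p : C, (hypersimplexColumns d p k : ℂ) * (w p * (θ p.1.1.1 * θ p.1.1.2)) =
      θ k * ∑ j : E, edgeMatrix (pairsEquiv C E hC) w k j * θ j := by
  classical
  set e := pairsEquiv C E hC with he
  have h1 : ∀ p : C, (hypersimplexColumns d p k : ℂ) * (w p * (θ p.1.1.1 * θ p.1.1.2)) =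
      if k ∈ (e p).1 then w p * (θ p.1.1.1 * θ p.1.1.2) else 0 := by
    intro p
    have := p.1.2.ne
    simp only [he, mem_pairsEquiv, hypersimplexColumns_apply]
    push_cast
    grind
  simp only [h1]
  rw [← Finset.sum_filter, Finset.mul_sum]
  have h2 : ∑ j : E, θ k * (edgeMatrix e w k j * θ j) =
      ∑ j : E with j ≠ k, θ k * (edgeMatrix e w k j * θ j) := by
    rw [Finset.sum_filter_of_ne]
    rintro j - h rfl
    simp [edgeMatrix] at h
  rw [h2]
  symm
  refine Finset.sum_bij (fun j hj => e.symm ⟨s(k, j), by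
    simpa using (Finset.mem_filter.mp hj).2.symm⟩) ?_ ?_ ?_ ?_
  · intro j hj
    simp
  · intro j hj j' hj' h
    have h1 := congrArg Subtype.val (e.symm.injective h)
    exact Sym2.congr_right.mp h1
  · intro p hp
    obtain ⟨j, hj⟩ := (Finset.mem_filter.mp hp).2
    have hjk : j ≠ k := by
      rintro rfl
      have := (e p).2
      rw [hj] at this
      simp at this
    refine ⟨j, by simpa using hjk, ?_⟩
    rw [Equiv.symm_apply_eq]
    exact Subtype.ext hj.symm
  · intro j hj
    have hjk : j ≠ k := (Finset.mem_filter.mp hj).2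
    have hval : edgeMatrix e w k j = w (e.symm ⟨s(k, j), by simpa using hjk.symm⟩) := by
      simp [edgeMatrix, hjk.symm]
    rw [hval]
    rcases lt_or_gt_of_ne hjk with h | h
    · have : (⟨s(k, j), by simpa using hjk.symm⟩ : {z : Sym2 E // ¬ z.IsDiag}) =
          ⟨s(j, k), by simpa using hjk⟩ := Subtype.ext Sym2.eq_swap
      rw [this, he, pairsEquiv_symm_of_lt C E hC h]
      ring
    · rw [he, pairsEquiv_symm_of_lt C E hC h]
      ring

theorem singularScalings_eq_torusKernel (hC : ∀ p, p ∈ C ↔ p.1.1 ∈ E ∧ p.1.2 ∈ E) :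
    singularScalings (fun p : C => hypersimplexColumns d p) = torusKernel (pairsEquiv C E hC) := by
  ext w
  rw [mem_singularScalings_hypersimplex, torusKernel, Set.mem_ofPred_eq]
  refine and_congr_right fun _ => ⟨?_, ?_⟩
  · rintro ⟨θ, hθ, h⟩
    refine ⟨fun k => θ k, fun k => hθ k, ?_⟩
    ext k
    have := h k
    rw [sum_hypersimplexColumns C E hC] at this
    exact (mul_eq_zero.mp this).resolve_left (hθ k)
  · rintro ⟨θ, hθ, h⟩
    classical
    -- Coordinates outside `E` occur in no monomial, so any nonzero filler works.
    obtain ⟨θ', hθ', hE⟩ : ∃ θ' : Fin d → ℂ, (∀ k, θ' k ≠ 0) ∧ ∀ k : E, θ' k = θ k := by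
      refine ⟨fun k => if hk : k ∈ E then θ ⟨k, hk⟩ else 1, fun k => ?_, fun k => by simp⟩
      by_cases hk : k ∈ E <;> simp [hk, hθ]
    refine ⟨θ', hθ', fun k => ?_⟩
    by_cases hk : k ∈ E
    · have h1 := sum_hypersimplexColumns C E hC w θ' ⟨k, hk⟩
      have h2 := congrFun h ⟨k, hk⟩
      simp only [mulVec, dotProduct, Pi.zero_apply] at h2
      simp only [hE, h2, mul_zero] at h1
      exact h1
    · refine Finset.sum_eq_zero fun p _ => ?_
      have hp := (hC p.1).mp p.2
      have h1 : k ≠ p.1.1.1 := by rintro rfl; exact hk hp.1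
      have h2 : k ≠ p.1.1.2 := by rintro rfl; exact hk hp.2
      simp [hypersimplexColumns_apply, h1, h2]

theorem rename_edgeDet_pairsEquiv (hC : ∀ p, p ∈ C ↔ p.1.1 ∈ E ∧ p.1.2 ∈ E) :
    MvPolynomial.rename Subtype.val (edgeDet (pairsEquiv C E hC)) = (scalingSubmatrix E).det := by
  rw [edgeDet, AlgHom.map_det]
  congr 1
  ext1 i j
  simp only [AlgHom.mapMatrix_apply, map_apply, scalingSubmatrix, submatrix_apply, scalingMatrix]
  rcases lt_trichotomy i j with h | h | h
  · have hlt : i.1 < j.1 := h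
    simp only [edgeMatrix, h.ne, hlt, dite_true, dite_false]
    rw [pairsEquiv_symm_of_lt C E hC h, MvPolynomial.rename_X]
  · simp [edgeMatrix, h]
  · have hlt : j.1 < i.1 := h
    rw [edgeMatrix_symm]
    simp only [edgeMatrix, h.ne, hlt, hlt.not_gt, dite_true, dite_false]
    rw [pairsEquiv_symm_of_lt C E hC h, MvPolynomial.rename_X]

theorem aDiscriminant_pairs (hC : ∀ p, p ∈ C ↔ p.1.1 ∈ E ∧ p.1.2 ∈ E) (hE : 4 ≤ E.card) :
    Associated (MvPolynomial.rename Subtype.val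
      (aDiscriminant fun p : C => hypersimplexColumns d p)) (scalingSubmatrix E).det := by
  rw [← rename_edgeDet_pairsEquiv C E hC]
  have hE' : 4 ≤ Fintype.card E := by simpa using hE
  refine Associated.map _ (aDiscriminant_associated _ (irreducible_edgeDet _ hE') ?_)
  rw [singularScalings_eq_torusKernel C E hC, vanishingIdeal_torusKernel _ hE']

end Columns

/-! ### Faces of the second hypersimplex -/

section Faces

variable {d : ℕ}

theorem toReal_hypersimplexColumns (p : Pairs d) (k : Fin d) :
    toReal d (hypersimplexColumns d p) k =
      (if k = p.1.1 then 1 else 0) + if k = p.1.2 then 1 else 0 := by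
  change ((hypersimplexColumns d p k : ℤ) : ℝ) = _
  rw [hypersimplexColumns_apply]
  push_cast
  rfl

theorem toReal_hypersimplexColumns_eq_indicator (p : Pairs d) :
    toReal d (hypersimplexColumns d p) = ({p.1.1, p.1.2} : Set (Fin d)).indicator 1 := by
  ext k
  have := p.2.ne
  rw [toReal_hypersimplexColumns, Set.indicator_apply]
  simp only [Set.mem_insert_iff, Set.mem_singleton_iff, Pi.one_apply]
  grind

theorem uniformMatroid_indep {r : ℕ} {E : Finset (Fin d)} {I : Set (Fin d)} :
    (uniformMatroid r E).Indep I ↔ I ⊆ E ∧ I.ncard ≤ r := by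
  simp [uniformMatroid]

theorem uniformMatroid_isBase {r : ℕ} {E : Finset (Fin d)} (hE : r ≤ E.card) {B : Set (Fin d)} :
    (uniformMatroid r E).IsBase B ↔ B ⊆ E ∧ B.ncard = r := by
  rw [Matroid.isBase_iff_maximal_indep, maximal_subset_iff]
  simp only [uniformMatroid_indep]
  constructor
  · rintro ⟨⟨hBE, hB⟩, hmax⟩
    refine ⟨hBE, le_antisymm hB (not_lt.mp fun hlt => ?_)⟩
    obtain ⟨x, hxE, hxB⟩ := Set.exists_mem_notMem_of_ncard_lt_ncard
      (s := B) (t := (E : Set (Fin d))) (by rw [Set.ncard_coe_finset]; omega)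
    have h1 := hmax (t := insert x B) ⟨Set.insert_subset hxE hBE, by
      rw [Set.ncard_insert_of_notMem hxB]; omega⟩ (Set.subset_insert x B)
    exact hxB (h1 ▸ Set.mem_insert x B)
  · rintro ⟨hBE, hB⟩
    refine ⟨⟨hBE, hB.le⟩, fun I hI hBI => ?_⟩
    exact Set.eq_of_subset_of_ncard_le hBI (by omega)

theorem matroidPolytope_uniformMatroid {E : Finset (Fin d)} (hE : 2 ≤ E.card) :
    matroidPolytope (uniformMatroid 2 E) = convexHull ℝ
      ((fun p => toReal d (hypersimplexColumns d p)) '' {p | p.1.1 ∈ E ∧ p.1.2 ∈ E}) := by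
  unfold matroidPolytope
  congr 1
  ext x
  simp only [uniformMatroid_isBase hE, Set.mem_ofPred_eq, Set.mem_image]
  constructor
  · rintro ⟨B, ⟨hBE, hB⟩, rfl⟩
    obtain ⟨i, j, hij, rfl⟩ := Set.ncard_eq_two.mp hB
    have hi : i ∈ E := hBE (by simp)
    have hj : j ∈ E := hBE (by simp)
    rcases lt_or_gt_of_ne hij with h | h
    · exact ⟨⟨(i, j), h⟩, ⟨hi, hj⟩, toReal_hypersimplexColumns_eq_indicator _⟩
    · refine ⟨⟨(j, i), h⟩, ⟨hj, hi⟩, ?_⟩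
      rw [toReal_hypersimplexColumns_eq_indicator, Set.pair_comm]
  · rintro ⟨p, ⟨h1, h2⟩, rfl⟩
    refine ⟨{p.1.1, p.1.2}, ⟨Set.insert_subset h1 (Set.singleton_subset_iff.mpr h2), ?_⟩,
      toReal_hypersimplexColumns_eq_indicator p⟩
    exact Set.ncard_pair p.2.ne

theorem mem_faceColumns {A : Pairs d → Fin d → ℤ} {Γ : Set (Fin d → ℝ)} {p : Pairs d} :
    p ∈ faceColumns A Γ ↔ toReal d (A p) ∈ Γ := by
  simp [faceColumns]

theorem mem_faceColumns_matroidPolytope {E : Finset (Fin d)} (hE : 2 ≤ E.card) (p : Pairs d) :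
    p ∈ faceColumns (hypersimplexColumns d) (matroidPolytope (uniformMatroid 2 E)) ↔
      p.1.1 ∈ E ∧ p.1.2 ∈ E := by
  rw [mem_faceColumns, matroidPolytope_uniformMatroid hE]
  constructor
  · intro h
    have key : ∀ k ∉ E, toReal d (hypersimplexColumns d p) k = 0 := by
      intro k hk
      have hconv : Convex ℝ {x : Fin d → ℝ | x k = 0} := by
        intro x hx y hy a b _ _ _
        simp only [Set.mem_ofPred_eq] at hx hy
        simp [hx, hy]
      refine convexHull_min ?_ hconv h
      rintro _ ⟨q, ⟨hq1, hq2⟩, rfl⟩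
      have h1 : k ≠ q.1.1 := by rintro rfl; exact hk hq1
      have h2 : k ≠ q.1.2 := by rintro rfl; exact hk hq2
      simp [toReal_hypersimplexColumns, h1, h2]
    constructor <;> by_contra hne <;> have := key _ hne <;>
      rw [toReal_hypersimplexColumns] at this <;> split_ifs at this <;> simp_all
  · intro h
    exact subset_convexHull ℝ _ ⟨p, h, rfl⟩

/-- A linear functional attains its maximum over the hull at the generating points, so comparing
columns suffices. This turns questions about faces into inequalities between the sums `c i + c j`.
-/
theorem exists_functional_of_mem_faces {ι : Type} {A : ι → Fin d → ℤ} {Γ : Set (Fin d → ℝ)}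
    (hΓ : Γ ∈ faces (configPolytope A)) : ∃ c : Fin d → ℝ, ∀ i, toReal d (A i) ∈ Γ ↔
      ∀ j, ∑ k, A j k * c k ≤ ∑ k, A i k * c k := by
  obtain ⟨hexp, hne⟩ := hΓ
  obtain ⟨l, hl⟩ := hexp hne
  refine ⟨fun k => l (Pi.single k 1), fun i => ?_⟩
  have hlA : ∀ i, l (toReal d (A i)) = ∑ k, A i k * l (Pi.single k 1) := by
    intro i
    rw [← l.coe_coe, LinearMap.pi_apply_eq_sum_univ l.toLinearMap]
    refine Finset.sum_congr rfl fun k _ => ?_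
    have : (fun j => if k = j then (1 : ℝ) else 0) = Pi.single k 1 := by
      ext j; simp [Pi.single_apply, eq_comm]
    rw [this]
    rfl
  have hvert : ∀ i, toReal d (A i) ∈ configPolytope A := fun i =>
    subset_convexHull ℝ _ ⟨i, rfl⟩
  rw [hl]
  simp only [← hlA]
  constructor
  · rintro ⟨-, h⟩ j
    exact h _ (hvert j)
  · intro h
    refine ⟨hvert i, fun y hy => ?_⟩
    have hconv : Convex ℝ {y | l y ≤ l (toReal d (A i))} :=
      convex_halfSpace_le l.toLinearMap.isLinear _
    refine convexHull_min ?_ hconv hy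
    rintro _ ⟨j, rfl⟩
    exact h j

theorem exposed_mem_faces {ι : Type} [Fintype ι] {A : ι → Fin d → ℤ} (c : Fin d → ℝ) (i : ι)
    (hi : ∀ j, ∑ k, A j k * c k ≤ ∑ k, A i k * c k) :
    ∃ Γ ∈ faces (configPolytope A), ∀ j, toReal d (A j) ∈ Γ ↔
      ∑ k, A i k * c k ≤ ∑ k, A j k * c k := by
  let l : StrongDual ℝ (Fin d → ℝ) := ∑ k, c k • ContinuousLinearMap.proj k
  have hlA : ∀ i, l (toReal d (A i)) = ∑ k, A i k * c k := by
    intro i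
    simp only [l, _root_.sum_apply, _root_.smul_apply, smul_eq_mul]
    exact Finset.sum_congr rfl fun k _ => mul_comm _ _
  have hvert : ∀ i, toReal d (A i) ∈ configPolytope A := fun i =>
    subset_convexHull ℝ _ ⟨i, rfl⟩
  have hmax : ∀ y ∈ configPolytope A, l y ≤ l (toReal d (A i)) := by
    intro y hy
    have hconv : Convex ℝ {y | l y ≤ l (toReal d (A i))} :=
      convex_halfSpace_le l.toLinearMap.isLinear _
    refine convexHull_min ?_ hconv hy
    rintro _ ⟨j, rfl⟩
    simp only [Set.mem_ofPred_eq, hlA]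
    exact hi j
  refine ⟨{x ∈ configPolytope A | ∀ y ∈ configPolytope A, l y ≤ l x},
    ⟨fun _ => ⟨l, rfl⟩, ⟨_, hvert i, hmax⟩⟩, fun j => ?_⟩
  rw [← hlA, ← hlA]
  exact ⟨fun h => h.2 _ (hvert i), fun h => ⟨hvert j, fun y hy => (hmax y hy).trans h⟩⟩

theorem sum_hypersimplexColumns_mul (p : Pairs d) (c : Fin d → ℝ) :
    ∑ k, hypersimplexColumns d p k * c k = c p.1.1 + c p.1.2 := by
  simp only [hypersimplexColumns_apply]
  push_cast
  simp [add_mul, Finset.sum_add_distrib]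

theorem eq_matroidPolytope_of_faceColumns {Γ : Set (Fin d → ℝ)}
    (hΓ : Γ ∈ faces (configPolytope (hypersimplexColumns d))) {E : Finset (Fin d)}
    (hE : 2 ≤ E.card)
    (h : ∀ p : Pairs d, toReal d (hypersimplexColumns d p) ∈ Γ ↔ p.1.1 ∈ E ∧ p.1.2 ∈ E) :
    Γ = matroidPolytope (uniformMatroid 2 E) := by
  rw [face_eq_convexHull _ hΓ, matroidPolytope_uniformMatroid hE]
  congr 2
  ext p
  rw [Finset.mem_coe, mem_faceColumns, h]
  rfl

theorem exists_pair {E : Finset (Fin d)} (hE : 2 ≤ E.card) :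
    ∃ p : Pairs d, p.1.1 ∈ E ∧ p.1.2 ∈ E := by
  obtain ⟨i, hi, j, hj, hij⟩ := Finset.one_lt_card.mp hE
  rcases lt_or_gt_of_ne hij with h | h
  · exact ⟨⟨(i, j), h⟩, hi, hj⟩
  · exact ⟨⟨(j, i), h⟩, hj, hi⟩

/-- The indicator of `E` takes its maximal value `2` exactly at the pairs inside `E`. -/
theorem matroidPolytope_mem_faces {E : Finset (Fin d)} (hE : 2 ≤ E.card) :
    matroidPolytope (uniformMatroid 2 E) ∈ faces (configPolytope (hypersimplexColumns d)) := by
  classical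
  obtain ⟨p, hp1, hp2⟩ := exists_pair hE
  obtain ⟨Γ, hΓ, h⟩ := exposed_mem_faces (A := hypersimplexColumns d)
    (fun k => if k ∈ E then 1 else 0) p (fun q => by
      rw [sum_hypersimplexColumns_mul, sum_hypersimplexColumns_mul]
      simp only [hp1, hp2, if_true]
      split_ifs <;> norm_num)
  rw [← eq_matroidPolytope_of_faceColumns hΓ hE fun q => ?_]
  · exact hΓ
  rw [h, sum_hypersimplexColumns_mul, sum_hypersimplexColumns_mul]
  simp only [hp1, hp2, if_true]
  by_cases h1 : q.1.1 ∈ E <;> by_cases h2 : q.1.2 ∈ E <;> simp [h1, h2]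

theorem matroidPolytope_injective {E E' : Finset (Fin d)} (hE : 2 ≤ E.card) (hE' : 2 ≤ E'.card)
    (h : matroidPolytope (uniformMatroid 2 E) = matroidPolytope (uniformMatroid 2 E')) :
    E = E' := by
  have key : ∀ {E E' : Finset (Fin d)}, 2 ≤ E.card → 2 ≤ E'.card →
      matroidPolytope (uniformMatroid 2 E) = matroidPolytope (uniformMatroid 2 E') → E ⊆ E' := by
    intro E E' hE hE' h k hk
    obtain ⟨j, hj, hjk⟩ := Finset.exists_mem_ne hE k
    rcases lt_or_gt_of_ne hjk with hlt | hlt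
    · have := (mem_faceColumns_matroidPolytope hE ⟨(j, k), hlt⟩).mpr ⟨hj, hk⟩
      rw [h, mem_faceColumns_matroidPolytope hE'] at this
      exact this.2
    · have := (mem_faceColumns_matroidPolytope hE ⟨(k, j), hlt⟩).mpr ⟨hk, hj⟩
      rw [h, mem_faceColumns_matroidPolytope hE'] at this
      exact this.1
  exact Finset.Subset.antisymm (key hE hE' h) (key hE' hE h.symm)

theorem faceDiscriminant_eq_one {Γ : Set (Fin d → ℝ)}
    (h : singularScalings (fun p : faceColumns (hypersimplexColumns d) Γ =>
      hypersimplexColumns d p) = ∅) : faceDiscriminant (hypersimplexColumns d) Γ = 1 := by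
  rw [faceDiscriminant, aDiscriminant_eq_one _ h, map_one]

theorem face_cases {Γ : Set (Fin d → ℝ)}
    (hΓ : Γ ∈ faces (configPolytope (hypersimplexColumns d))) :
    (∃ E : Finset (Fin d), 4 ≤ E.card ∧ Γ = matroidPolytope (uniformMatroid 2 E)) ∨
      faceDiscriminant (hypersimplexColumns d) Γ = 1 := by
  classical
  obtain ⟨c, hc⟩ := exists_functional_of_mem_faces hΓ
  simp only [sum_hypersimplexColumns_mul] at hc
  obtain ⟨p₀, hp₀⟩ : ∃ p, toReal d (hypersimplexColumns d p) ∈ Γ := by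
    have hne := hΓ.2
    rw [face_eq_convexHull _ hΓ, convexHull_nonempty_iff] at hne
    obtain ⟨_, p, hp, -⟩ := hne
    exact ⟨p, mem_faceColumns.mp hp⟩
  have : Nonempty (Fin d) := ⟨p₀.1.1⟩
  obtain ⟨a, ha⟩ := Finite.exists_max c
  let M : Finset (Fin d) := Finset.univ.filter fun k => c k = c a
  have hM : ∀ {k}, k ∈ M ↔ c k = c a := by simp [M]
  rcases Nat.lt_or_ge M.card 2 with hM2 | hM2
  · right
    have honly : ∀ k, c k = c a → k = a := fun k hk =>
      Finset.card_le_one.mp (by omega) _ (hM.mpr hk) _ (hM.mpr rfl)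
    have hmem : ∀ p : Pairs d, toReal d (hypersimplexColumns d p) ∈ Γ → a = p.1.1 ∨ a = p.1.2 := by
      intro p hp
      by_contra! hne
      have h1 : c p.1.1 < c a := lt_of_le_of_ne (ha _) fun h => hne.1 (honly _ h).symm
      have hp := (hc p).mp hp
      rcases lt_or_gt_of_ne hne.2 with h | h
      · have := hp ⟨(a, p.1.2), h⟩
        simp only at this
        linarith
      · have := hp ⟨(p.1.2, a), h⟩
        simp only at this
        linarith
    -- All pairs of the face contain `a`, so the other endpoint `k` of `p₀` is a vertex of degree
    -- one.
    obtain ⟨k, hka, hk⟩ : ∃ k, k ≠ a ∧ (k = p₀.1.1 ∨ k = p₀.1.2) := by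
      rcases hmem p₀ hp₀ with h | h
      · exact ⟨p₀.1.2, by rw [h]; exact p₀.2.ne', Or.inr rfl⟩
      · exact ⟨p₀.1.1, by rw [h]; exact p₀.2.ne, Or.inl rfl⟩
    apply faceDiscriminant_eq_one
    refine singularScalings_eq_empty_of_unique _ k p₀ (mem_faceColumns.mpr hp₀) hk ?_
    intro q hq hkq
    have h1 := hmem q (mem_faceColumns.mp hq)
    have h2 := hmem p₀ hp₀
    have h3 := q.2
    have h4 := p₀.2
    ext1
    ext1 <;> grind
  · have hpairs : ∀ p : Pairs d, toReal d (hypersimplexColumns d p) ∈ Γ ↔ p.1.1 ∈ M ∧ p.1.2 ∈ M := by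
      intro p
      rw [hc, hM, hM]
      constructor
      · intro h
        obtain ⟨q, hq1, hq2⟩ := exists_pair hM2
        have := h q
        rw [hM.mp hq1, hM.mp hq2] at this
        constructor <;> linarith [ha p.1.1, ha p.1.2]
      · rintro ⟨h1, h2⟩ q
        rw [h1, h2]
        linarith [ha q.1.1, ha q.1.2]
    rcases Nat.lt_or_ge M.card 4 with hM4 | hM4
    · right
      apply faceDiscriminant_eq_one
      -- Two maxima give a single edge, three give a triangle.
      have : M.card = 2 ∨ M.card = 3 := by omega
      rcases this with h | h
      · obtain ⟨h1, h2⟩ := (hpairs p₀).mp hp₀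
        refine singularScalings_eq_empty_of_unique _ p₀.1.1 p₀ (mem_faceColumns.mpr hp₀)
          (Or.inl rfl) fun q hq _ => ?_
        obtain ⟨h3, h4⟩ := (hpairs q).mp (mem_faceColumns.mp hq)
        obtain ⟨x, y, hxy, hxyM⟩ := Finset.card_eq_two.mp h
        rw [hxyM] at h1 h2 h3 h4
        have h5 := q.2
        have h6 := p₀.2
        simp only [Finset.mem_insert, Finset.mem_singleton] at h1 h2 h3 h4
        ext1
        ext1 <;> grind
      · let f := M.orderEmbOfFin h
        have h01 : f 0 < f 1 := f.strictMono (by decide)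
        have h12 : f 1 < f 2 := f.strictMono (by decide)
        have hMf : ∀ k, k ∈ M ↔ k = f 0 ∨ k = f 1 ∨ k = f 2 := by
          intro k
          have : k ∈ (M : Set (Fin d)) ↔ k ∈ Set.range f := by
            rw [Finset.range_orderEmbOfFin]
          rw [← Finset.mem_coe, this]
          simp only [Set.mem_range, Fin.exists_fin_succ]
          simp [eq_comm]
        refine singularScalings_eq_empty_of_triangle _ h01 h12 fun p => ?_
        rw [mem_faceColumns, hpairs, hMf, hMf]
        obtain ⟨⟨x, y⟩, hp⟩ := p
        simp only [Subtype.mk.injEq, Prod.mk.injEq]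
        simp only at hp
        constructor
        · rintro ⟨rfl | rfl | rfl, rfl | rfl | rfl⟩ <;> first | (exfalso; order) | simp
        · rintro (⟨rfl, rfl⟩ | ⟨rfl, rfl⟩ | ⟨rfl, rfl⟩) <;> simp
    · exact Or.inl ⟨M, hM4, eq_matroidPolytope_of_faceColumns hΓ hM2 hpairs⟩

theorem faceDiscriminant_matroidPolytope {E : Finset (Fin d)} (hE : 4 ≤ E.card) :
    Associated (faceDiscriminant (hypersimplexColumns d) (matroidPolytope (uniformMatroid 2 E)))
      (scalingSubmatrix E).det :=
  aDiscriminant_pairs _ E (mem_faceColumns_matroidPolytope (by omega)) hE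

theorem not_isUnit_det_scalingSubmatrix {E : Finset (Fin d)} (hE : 4 ≤ E.card) :
    ¬ IsUnit (scalingSubmatrix E).det := by
  intro h
  have h1 := h.map (MvPolynomial.eval (0 : Pairs d → ℂ))
  obtain ⟨k, hk⟩ := Finset.card_pos.mp (by omega : 0 < E.card)
  rw [RingHom.map_det] at h1
  refine h1.ne_zero (Matrix.det_eq_zero_of_row_eq_zero ⟨k, hk⟩ fun j => ?_)
  simp only [RingHom.mapMatrix_apply, Matrix.map_apply, scalingSubmatrix, Matrix.submatrix_apply,
    scalingMatrix]
  split_ifs <;> simp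

theorem uniformMatroid_delete (D : Finset (Fin d)) :
    (uniformMatroid 2 Finset.univ).delete (D : Set (Fin d)) = uniformMatroid 2 Dᶜ := by
  apply Matroid.ext_indep
  · change (((Finset.univ : Finset (Fin d)) : Set (Fin d)) \ D) = ((Dᶜ : Finset (Fin d)) : Set (Fin d))
    ext; simp
  · intro I _
    rw [Matroid.delete_indep_iff, uniformMatroid_indep, uniformMatroid_indep, Finset.coe_compl,
      Set.subset_compl_iff_disjoint_right]
    simp
    tauto

end Faces

/-! ### The corner of the orthant and unimodular changes of lattice basis -/

section Corner

/-- The points of `ℝʳ` with natural coordinates. -/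
def natPoints (r : ℕ) : Set (Fin r → ℝ) := Set.range fun (n : Fin r → ℕ) i => (n i : ℝ)

/-- The part of the orthant below the standard simplex. -/
def orthantCorner (r : ℕ) (c : ℝ) : Set (Fin r → ℝ) := {y | (∀ i, 0 ≤ y i) ∧ ∑ i, y i < c}

variable {r : ℕ}

/-- On the axis, `s` lies between the lattice points `1` and `⌈s⌉₊`. -/
theorem single_mem_convexHull_natPoints (i : Fin r) {s : ℝ} (hs : 1 ≤ s) :
    Pi.single i s ∈ convexHull ℝ (natPoints r \ {0}) := by
  have hvert : ∀ n : ℕ, 1 ≤ n → Pi.single i (n : ℝ) ∈ convexHull ℝ (natPoints r \ {0}) := by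
    intro n hn
    refine subset_convexHull ℝ _ ⟨⟨Pi.single i n, ?_⟩, ?_⟩
    · ext j
      by_cases h : j = i
      · subst h; simp
      · simp [h]
    · rw [Set.mem_singleton_iff, Pi.single_eq_zero_iff]
      norm_cast
      omega
  have hN : s ≤ ⌈s⌉₊ := Nat.le_ceil s
  have h1 : (1 : ℝ) ≤ (⌈s⌉₊ : ℝ) := hs.trans hN
  have hseg : s ∈ segment ℝ ((1 : ℕ) : ℝ) (⌈s⌉₊ : ℝ) := by
    rw [Nat.cast_one, segment_eq_Icc h1]; exact ⟨hs, hN⟩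
  obtain ⟨a, b, ha, hb, hab, heq⟩ := hseg
  have h2 := (convex_convexHull ℝ (natPoints r \ {0})) (hvert 1 le_rfl)
    (hvert _ (by exact_mod_cast h1)) ha hb hab
  rwa [← Pi.single_smul, ← Pi.single_smul, ← Pi.single_add, heq] at h2

/-- With `s` the coordinate sum, `y` is the convex combination of the axis points `s eᵢ` with
weights `yᵢ / s`. -/
theorem mem_convexHull_natPoints_diff {y : Fin r → ℝ} (hy : ∀ i, 0 ≤ y i) (hs : 1 ≤ ∑ i, y i) :
    y ∈ convexHull ℝ (natPoints r \ {0}) := by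
  set s := ∑ i, y i with hs_def
  have hs0 : s ≠ 0 := by linarith
  have : y = ∑ i, (y i / s) • (Pi.single i s : Fin r → ℝ) := by
    ext j
    simp only [Finset.sum_apply, Pi.smul_apply, smul_eq_mul, Pi.single_apply, mul_ite, mul_zero,
      Finset.sum_ite_eq, Finset.mem_univ, if_true]
    field_simp
  rw [this]
  refine (convex_convexHull ℝ _).sum_mem (fun i _ => div_nonneg (hy i) (by linarith)) ?_
    fun i _ => single_mem_convexHull_natPoints i hs
  rw [← Finset.sum_div, ← hs_def, div_self hs0]

theorem mem_convexHull_natPoints {y : Fin r → ℝ} (hy : ∀ i, 0 ≤ y i) :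
    y ∈ convexHull ℝ (natPoints r) := by
  have hmono : convexHull ℝ (natPoints r \ {0}) ⊆ convexHull ℝ (natPoints r) :=
    convexHull_mono Set.sdiff_subset
  have h0 : (0 : Fin r → ℝ) ∈ convexHull ℝ (natPoints r) :=
    subset_convexHull ℝ _ ⟨0, by ext; simp⟩
  rcases le_or_gt 1 (∑ i, y i) with h | h
  · exact hmono (mem_convexHull_natPoints_diff hy h)
  have hs : 0 ≤ ∑ i, y i := Finset.sum_nonneg fun i _ => hy i
  set s := ∑ i, y i with hs_def
  rcases hs.eq_or_lt with h0' | hpos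
  · have : y = 0 := by
      ext i
      exact (Finset.sum_eq_zero_iff_of_nonneg (fun i _ => hy i)).mp (hs_def ▸ h0'.symm) i
        (Finset.mem_univ i)
    rw [this]
    exact h0
  · have h1 : s⁻¹ • y ∈ convexHull ℝ (natPoints r) := by
      refine hmono (mem_convexHull_natPoints_diff
        (fun i => mul_nonneg (inv_nonneg.mpr hs) (hy i)) ?_)
      simp only [Pi.smul_apply, smul_eq_mul, ← Finset.mul_sum]
      rw [← hs_def, inv_mul_cancel₀ hpos.ne']
    have h2 := (convex_convexHull ℝ (natPoints r)).smul_mem_of_zero_mem h0 h1 ⟨hs, h.le⟩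
    rwa [smul_inv_smul₀ hpos.ne'] at h2

/-- A nonzero vector with natural coordinates has sum at least `1`, so removing the origin cuts the
orthant exactly along the hyperplane of sum `1`. -/
theorem convexHull_natPoints_diff :
    convexHull ℝ (natPoints r) \ convexHull ℝ (natPoints r \ {0}) = orthantCorner r 1 := by
  ext y
  constructor
  · rintro ⟨h1, h2⟩
    have hy : ∀ i, 0 ≤ y i := by
      intro i
      have hconv : Convex ℝ {y : Fin r → ℝ | 0 ≤ y i} :=
        convex_halfSpace_ge (LinearMap.proj i : (Fin r → ℝ) →ₗ[ℝ] ℝ).isLinear 0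
      refine convexHull_min ?_ hconv h1
      rintro _ ⟨n, rfl⟩
      exact Nat.cast_nonneg (α := ℝ) _
    exact ⟨hy, not_le.mp fun h => h2 (mem_convexHull_natPoints_diff hy h)⟩
  · rintro ⟨hy, hs⟩
    refine ⟨mem_convexHull_natPoints hy, fun h => not_le.mpr hs ?_⟩
    have hconv : Convex ℝ {y : Fin r → ℝ | 1 ≤ (∑ i, LinearMap.proj i : (Fin r → ℝ) →ₗ[ℝ] ℝ) y} :=
      convex_halfSpace_ge (LinearMap.isLinear _) 1
    have := convexHull_min ?_ hconv h
    · simpa using this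
    rintro _ ⟨⟨n, rfl⟩, hn⟩
    simp only [Set.mem_ofPred_eq, LinearMap.sum_apply, LinearMap.proj_apply]
    have : 0 < ∑ i, n i := by
      rw [Nat.pos_iff_ne_zero]
      intro h0
      apply hn
      rw [Finset.sum_eq_zero_iff] at h0
      ext i
      simp [h0 i (Finset.mem_univ i)]
    exact_mod_cast this

theorem measurableSet_orthantCorner (c : ℝ) : MeasurableSet (orthantCorner r c) := by
  have : orthantCorner r c = (⋂ i, {y | 0 ≤ y i}) ∩ {y | ∑ i, y i < c} := by
    ext; simp [orthantCorner]
  rw [this]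
  refine MeasurableSet.inter (MeasurableSet.iInter fun i => ?_) ?_
  · exact measurableSet_le measurable_const (measurable_pi_apply i)
  · exact measurableSet_lt (Finset.measurable_sum _ fun i _ => measurable_pi_apply i)
      measurable_const

-- Slicing at first coordinate `t` leaves a corner of size `c - t`, one dimension lower; hence the
-- induction over all `c`.
open MeasureTheory in
theorem volume_orthantCorner (r : ℕ) {c : ℝ} (hc : 0 < c) :
    volume (orthantCorner r c) = ENNReal.ofReal (c ^ r / r.factorial) := by
  induction r generalizing c with
  | zero =>
    have : orthantCorner 0 c = Set.univ := by
      ext y; simp [orthantCorner, hc]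
    rw [this]
    simp [volume_pi]
  | succ r ih =>
    have hmp := (volume_preserving_piFinSuccAbove (fun _ : Fin (r + 1) => ℝ) 0).symm
    rw [← hmp.measure_preimage_equiv, Measure.volume_eq_prod,
      Measure.prod_apply ((MeasurableEquiv.measurable _) (measurableSet_orthantCorner c))]
    have hslice : ∀ t : ℝ, volume (Prod.mk t ⁻¹'
        ((MeasurableEquiv.piFinSuccAbove (fun _ : Fin (r + 1) => ℝ) 0).symm ⁻¹'
          orthantCorner (r + 1) c)) =
        (Set.Ico 0 c).indicator (fun t => ENNReal.ofReal ((c - t) ^ r / r.factorial)) t := by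
      intro t
      have hset : Prod.mk t ⁻¹' ((MeasurableEquiv.piFinSuccAbove (fun _ : Fin (r + 1) => ℝ) 0).symm ⁻¹'
          orthantCorner (r + 1) c) = {y | 0 ≤ t ∧ y ∈ orthantCorner r (c - t)} := by
        ext y
        simp only [Set.mem_preimage, orthantCorner, Set.mem_ofPred_eq,
          MeasurableEquiv.piFinSuccAbove_symm_apply, Fin.insertNthEquiv, Equiv.coe_fn_mk,
          Fin.insertNth_zero', Fin.forall_fin_succ, Fin.sum_univ_succ, Fin.cons_zero,
          Fin.cons_succ, lt_sub_iff_add_lt']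
        tauto
      rw [hset]
      by_cases ht : t ∈ Set.Ico 0 c
      · rw [Set.indicator_of_mem ht, ← ih (sub_pos.mpr ht.2)]
        simp [ht.1]
      · rw [Set.indicator_of_notMem ht]
        convert! measure_empty (μ := volume)
        rw [Set.eq_empty_iff_forall_notMem]
        rintro y ⟨h0, hy, hs⟩
        have := Finset.sum_nonneg fun i (_ : i ∈ Finset.univ) => hy i
        exact ht ⟨h0, by linarith⟩
    simp only [hslice]
    rw [lintegral_indicator measurableSet_Ico, ← ofReal_integral_eq_lintegral_ofReal]
    · congr 1
      rw [integral_Ico_eq_integral_Ioo, ← integral_Ioc_eq_integral_Ioo,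
        ← intervalIntegral.integral_of_le hc.le, intervalIntegral.integral_div,
        intervalIntegral.integral_comp_sub_left (fun t => t ^ r) c, integral_pow,
        Nat.factorial_succ]
      push_cast
      simp
      field_simp
    · refine (Continuous.integrableOn_Icc (by fun_prop)).mono_set Set.Ico_subset_Icc_self
    · refine (ae_restrict_iff' measurableSet_Ico).mpr (ae_of_all _ fun t ht => ?_)
      exact div_nonneg (pow_nonneg (sub_nonneg.mpr ht.2.le) _) (Nat.cast_nonneg _)

/-- The subdiagram volume of a free commutative monoid on a basis of a lattice, in the coordinates
of any other basis. -/
theorem volume_subdiagram_of_basis {Q : Type*} [AddCommGroup Q] (b b' : Module.Basis (Fin r) ℤ Q)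
    (S : Set Q) (hS : ∀ x, x ∈ S ↔ ∀ i, 0 ≤ b'.repr x i) :
    (MeasureTheory.volume
      (convexHull ℝ ((fun x j => (b.repr x j : ℝ)) '' S) \
        convexHull ℝ ((fun x j => (b.repr x j : ℝ)) '' (S \ {0})))).toReal =
      1 / (r.factorial : ℝ) := by
  let T : (Fin r → ℝ) →ₗ[ℝ] (Fin r → ℝ) := Matrix.toLin' ((b.toMatrix b').map (Int.castRingHom ℝ))
  have hT : ∀ x, T (fun j => (b'.repr x j : ℝ)) = fun j => (b.repr x j : ℝ) := by
    intro x
    have h := b'.toMatrix_mulVec_repr b x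
    ext j
    rw [Matrix.toLin'_apply, ← congrFun h j]
    simp [Matrix.mulVec, dotProduct]
  -- The change of basis is invertible over `ℤ`, so its determinant is `±1` and volume is preserved.
  have hdet : |LinearMap.det T| = 1 := by
    rw [LinearMap.det_toLin', ← RingHom.mapMatrix_apply, ← RingHom.map_det]
    have hu : IsUnit (b.toMatrix b').det := b.isUnit_det b'
    rcases Int.isUnit_iff.mp hu with h | h <;> simp [h]
  have hdet0 : LinearMap.det T ≠ 0 := by
    intro h; rw [h] at hdet; simp at hdet
  have hinj : Function.Injective T :=
    (T.equivOfDetNeZero hdet0).injective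
  have himg : (fun x j => (b'.repr x j : ℝ)) '' S = natPoints r := by
    ext y
    constructor
    · rintro ⟨x, hx, rfl⟩
      refine ⟨fun j => (b'.repr x j).toNat, ?_⟩
      ext j
      have := Int.toNat_of_nonneg ((hS x).mp hx j)
      change ((_ : ℕ) : ℝ) = ((b'.repr x j : ℤ) : ℝ)
      exact_mod_cast this
    · rintro ⟨n, rfl⟩
      refine ⟨b'.equivFun.symm fun j => n j, (hS _).mpr fun i => ?_, ?_⟩
      · rw [← b'.equivFun_apply, LinearEquiv.apply_symm_apply]
        exact Int.natCast_nonneg _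
      · ext j
        change ((b'.repr _ j : ℤ) : ℝ) = ((n j : ℕ) : ℝ)
        rw [← b'.equivFun_apply, LinearEquiv.apply_symm_apply]
        simp
  have hcinj : Function.Injective fun (x : Q) j => (b'.repr x j : ℝ) := by
    intro x x' h
    apply b'.repr.injective
    ext j
    exact Int.cast_injective (congrFun h j)
  have himg0 : (fun x j => (b'.repr x j : ℝ)) '' (S \ {0}) = natPoints r \ {0} := by
    rw [Set.image_sdiff hcinj, himg, Set.image_singleton]
    congr 2
    ext j
    simp
  have hcomp : ∀ X : Set Q, (fun x j => (b.repr x j : ℝ)) '' X =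
      T '' ((fun x j => (b'.repr x j : ℝ)) '' X) := by
    intro X
    rw [Set.image_image]
    simp only [hT]
  rw [hcomp, hcomp, himg, himg0, ← LinearMap.image_convexHull, ← LinearMap.image_convexHull,
    ← Set.image_sdiff hinj, convexHull_natPoints_diff,
    MeasureTheory.Measure.addHaar_image_linearMap, hdet, ENNReal.ofReal_one, one_mul,
    volume_orthantCorner r one_pos, ENNReal.toReal_ofReal (by positivity), one_pow]

end Corner

/-! ### The exponents of the hypersimplicial faces -/

section Exponents

variable {d : ℕ}

theorem even_sum_of_mem_columnLattice {v : Fin d → ℤ}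
    (hv : v ∈ columnLattice (hypersimplexColumns d)) : Even (∑ k, v k) := by
  induction hv using Submodule.span_induction with
  | mem x h =>
    obtain ⟨p, rfl⟩ := h
    simp only [hypersimplexColumns_apply, Finset.sum_add_distrib, Finset.sum_ite_eq',
      Finset.mem_univ, if_true]
    decide
  | zero => simp
  | add x y _ _ hx hy => simpa [Finset.sum_add_distrib] using hx.add hy
  | smul a x _ hx => simpa [← Finset.mul_sum] using hx.mul_left a

variable {Γ : Set (Fin d → ℝ)} {E : Finset (Fin d)}

theorem single_add_single_mem_faceLattice
    (hC : ∀ p, p ∈ faceColumns (hypersimplexColumns d) Γ ↔ p.1.1 ∈ E ∧ p.1.2 ∈ E)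
    {i j : Fin d} (hi : i ∈ E) (hj : j ∈ E) (hij : i ≠ j) :
    (Pi.single i 1 + Pi.single j 1 : Fin d → ℤ) ∈ faceLattice (hypersimplexColumns d) Γ := by
  rcases lt_or_gt_of_ne hij with h | h
  · exact Submodule.subset_span ⟨⟨(i, j), h⟩, (hC _).mpr ⟨hi, hj⟩, rfl⟩
  · rw [add_comm]
    exact Submodule.subset_span ⟨⟨(j, i), h⟩, (hC _).mpr ⟨hj, hi⟩, rfl⟩

/-- With three elements `a`, `b`, `c` of `E`, `2 e_a = (e_a + e_b) + (e_a + e_c) - (e_b + e_c)`, and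
`e_k - e_a` is a difference of two columns through a common third vertex. These generate every
vector of even sum supported on `E`. -/
theorem mem_faceLattice_of_even (hE : 3 ≤ E.card)
    (hC : ∀ p, p ∈ faceColumns (hypersimplexColumns d) Γ ↔ p.1.1 ∈ E ∧ p.1.2 ∈ E)
    {v : Fin d → ℤ} (hv : Even (∑ k, v k)) (hsupp : ∀ k ∉ E, v k = 0) :
    v ∈ faceLattice (hypersimplexColumns d) Γ := by
  obtain ⟨a, ha, b, hb, c, hc, hab, hac, hbc⟩ := Finset.two_lt_card.mp hE
  have hmem := fun {i j} => single_add_single_mem_faceLattice (i := i) (j := j) hC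
  have h2a : (2 : ℤ) • (Pi.single a 1 : Fin d → ℤ) ∈ faceLattice (hypersimplexColumns d) Γ := by
    have := Submodule.sub_mem _ (Submodule.add_mem _ (hmem ha hb hab) (hmem ha hc hac))
      (hmem hb hc hbc)
    convert! this using 1
    rw [two_smul]
    abel
  have hdiff : ∀ k ∈ E, (Pi.single k 1 - Pi.single a 1 : Fin d → ℤ) ∈
      faceLattice (hypersimplexColumns d) Γ := by
    intro k hk
    by_cases hka : k = a
    · rw [hka, sub_self]; exact Submodule.zero_mem _
    obtain ⟨x, hx, hxk, hxa⟩ : ∃ x ∈ E, x ≠ k ∧ x ≠ a := by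
      by_cases hkb : k = b
      · exact ⟨c, hc, by rw [hkb]; exact hbc.symm, hac.symm⟩
      · exact ⟨b, hb, fun h => hkb h.symm, hab.symm⟩
    have := Submodule.sub_mem _ (hmem hk hx hxk.symm) (hmem ha hx hxa.symm)
    convert! this using 1
    abel
  obtain ⟨m, hm⟩ := hv
  have hv : v = ∑ k, v k • (Pi.single k 1 - Pi.single a 1 : Fin d → ℤ) +
      m • ((2 : ℤ) • (Pi.single a 1 : Fin d → ℤ)) := by
    simp only [smul_sub, Finset.sum_sub_distrib, ← Finset.sum_smul]
    rw [hm, smul_smul, mul_two, sub_add_cancel]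
    ext j
    simp [Finset.sum_apply, Pi.single_apply]
  rw [hv]
  refine Submodule.add_mem _ (Submodule.sum_mem _ fun k _ => ?_) (Submodule.smul_mem _ _ h2a)
  by_cases hk : k ∈ E
  · exact Submodule.smul_mem _ _ (hdiff k hk)
  · rw [hsupp k hk, zero_smul]; exact Submodule.zero_mem _

/-- Vectors of the column lattice have even sum, so support in `E` alone places them in the face
lattice, and a fortiori in its real span. -/
theorem mem_saturatedFaceLattice (hE : 3 ≤ E.card)
    (hC : ∀ p, p ∈ faceColumns (hypersimplexColumns d) Γ ↔ p.1.1 ∈ E ∧ p.1.2 ∈ E)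
    (v : columnLattice (hypersimplexColumns d)) :
    v ∈ saturatedFaceLattice (hypersimplexColumns d) Γ ↔ ∀ k ∉ E, v.1 k = 0 := by
  constructor
  · intro hv k hk
    have hle : Submodule.span ℝ (toReal d '' (hypersimplexColumns d ''
        (faceColumns (hypersimplexColumns d) Γ : Set (Pairs d)))) ≤
        LinearMap.ker (LinearMap.proj k : (Fin d → ℝ) →ₗ[ℝ] ℝ) := by
      rw [Submodule.span_le]
      rintro _ ⟨_, ⟨p, hp, rfl⟩, rfl⟩
      obtain ⟨h1, h2⟩ := (hC p).mp hp
      have h3 : k ≠ p.1.1 := by rintro rfl; exact hk h1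
      have h4 : k ≠ p.1.2 := by rintro rfl; exact hk h2
      simp [toReal_hypersimplexColumns, h3, h4]
    have h : ((v.1 k : ℤ) : ℝ) = 0 := hle hv
    exact_mod_cast h
  · intro hv
    have hmem := mem_faceLattice_of_even hE hC (even_sum_of_mem_columnLattice v.2) hv
    have hle : faceLattice (hypersimplexColumns d) Γ ≤
        ((Submodule.span ℝ (toReal d '' (hypersimplexColumns d ''
        (faceColumns (hypersimplexColumns d) Γ : Set (Pairs d))))).restrictScalars ℤ).comap
          (toReal d) := by
      rw [faceLattice, Submodule.span_le]
      intro x hx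
      exact Submodule.subset_span ⟨x, hx, rfl⟩
    exact hle hmem

theorem faceIndex_eq_one (hE : 3 ≤ E.card)
    (hC : ∀ p, p ∈ faceColumns (hypersimplexColumns d) Γ ↔ p.1.1 ∈ E ∧ p.1.2 ∈ E) :
    faceIndex (hypersimplexColumns d) Γ = 1 := by
  rw [faceIndex, AddSubgroup.relIndex_eq_one]
  rintro _ ⟨v, hv, rfl⟩
  exact mem_faceLattice_of_even hE hC (even_sum_of_mem_columnLattice v.2)
    ((mem_saturatedFaceLattice hE hC v).mp hv)

/-- The coordinates outside `E`. -/
def outerCoords (E : Finset (Fin d)) :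
    columnLattice (hypersimplexColumns d) →ₗ[ℤ] ({k // k ∉ E} → ℤ) :=
  LinearMap.funLeft ℤ ℤ Subtype.val ∘ₗ (columnLattice (hypersimplexColumns d)).subtype

theorem ker_outerCoords (hE : 3 ≤ E.card)
    (hC : ∀ p, p ∈ faceColumns (hypersimplexColumns d) Γ ↔ p.1.1 ∈ E ∧ p.1.2 ∈ E) :
    saturatedFaceLattice (hypersimplexColumns d) Γ = LinearMap.ker (outerCoords E) := by
  ext v
  rw [mem_saturatedFaceLattice hE hC, LinearMap.mem_ker, funext_iff]
  exact ⟨fun h k => h k.1 k.2, fun h k hk => h ⟨k, hk⟩⟩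

/-- The column `e_k + e_a` with `a ∈ E` loses its second summand under the projection. -/
theorem exists_column_outerCoords {a : Fin d} (ha : a ∈ E) (k : {k // k ∉ E}) :
    ∃ p : Pairs d, outerCoords E ⟨hypersimplexColumns d p, Submodule.subset_span ⟨p, rfl⟩⟩ =
      Pi.single k 1 := by
  have hka : k.1 ≠ a := by intro h; exact k.2 (h ▸ ha)
  have key : ∀ j : {k // k ∉ E}, (if j.1 = k.1 then (1 : ℤ) else 0) + (if j.1 = a then 1 else 0) =
      (Pi.single k 1 : {k // k ∉ E} → ℤ) j := by
    intro j
    have : j.1 ≠ a := by intro h; exact j.2 (h ▸ ha)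
    simp [this, Pi.single_apply, Subtype.ext_iff]
  rcases lt_or_gt_of_ne hka with h | h
  · refine ⟨⟨(k.1, a), h⟩, ?_⟩
    ext j
    rw [← key]
    exact hypersimplexColumns_apply _ _
  · refine ⟨⟨(a, k.1), h⟩, ?_⟩
    ext j
    rw [← key, add_comm]
    exact hypersimplexColumns_apply _ _

theorem outerCoords_surjective (hE : E.Nonempty) : Function.Surjective (outerCoords E) := by
  classical
  obtain ⟨a, ha⟩ := hE
  rw [← LinearMap.range_eq_top, eq_top_iff]
  intro u _
  have hu : u = ∑ k, u k • (Pi.single k 1 : {k // k ∉ E} → ℤ) := by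
    ext j; simp [Finset.sum_apply, Pi.single_apply]
  rw [hu]
  refine Submodule.sum_mem _ fun k _ => Submodule.smul_mem _ _ ?_
  obtain ⟨p, hp⟩ := exists_column_outerCoords ha k
  exact ⟨_, hp⟩

/-- The quotient lattice of a hypersimplicial face is the lattice of the other coordinates. -/
def quotientLatticeEquiv (hE : 3 ≤ E.card)
    (hC : ∀ p, p ∈ faceColumns (hypersimplexColumns d) Γ ↔ p.1.1 ∈ E ∧ p.1.2 ∈ E) :
    QuotientLattice (hypersimplexColumns d) Γ ≃ₗ[ℤ] ({k // k ∉ E} → ℤ) :=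
  (Submodule.quotEquivOfEq _ _ (ker_outerCoords hE hC)).trans
    ((outerCoords E).quotKerEquivOfSurjective
      (outerCoords_surjective (Finset.card_pos.mp (by omega))))

theorem quotientLatticeEquiv_mkQ (hE : 3 ≤ E.card)
    (hC : ∀ p, p ∈ faceColumns (hypersimplexColumns d) Γ ↔ p.1.1 ∈ E ∧ p.1.2 ∈ E)
    (v : columnLattice (hypersimplexColumns d)) :
    quotientLatticeEquiv hE hC ((saturatedFaceLattice (hypersimplexColumns d) Γ).mkQ v) =
      outerCoords E v := rfl

/-- Columns project to nonnegative vectors, and every unit vector is the projection of a column. -/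
theorem mem_quotientSemigroup (hE : 3 ≤ E.card)
    (hC : ∀ p, p ∈ faceColumns (hypersimplexColumns d) Γ ↔ p.1.1 ∈ E ∧ p.1.2 ∈ E)
    (x : QuotientLattice (hypersimplexColumns d) Γ) :
    x ∈ quotientSemigroup (hypersimplexColumns d) Γ ↔ ∀ k, 0 ≤ quotientLatticeEquiv hE hC x k := by
  classical
  constructor
  · intro hx
    induction hx using AddSubmonoid.closure_induction with
    | mem x h =>
      obtain ⟨p, rfl⟩ := h
      intro k
      rw [quotientLatticeEquiv_mkQ]
      change 0 ≤ hypersimplexColumns d p k.1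
      rw [hypersimplexColumns_apply]
      split_ifs <;> simp
    | zero => simp
    | add x y _ _ hx hy =>
      intro k
      rw [map_add]
      exact add_nonneg (hx k) (hy k)
  · intro h
    obtain ⟨a, ha⟩ : E.Nonempty := Finset.card_pos.mp (by omega)
    choose p hp using fun k => exists_column_outerCoords ha k
    have hx : x = ∑ k, (quotientLatticeEquiv hE hC x k).toNat •
        (saturatedFaceLattice (hypersimplexColumns d) Γ).mkQ
          ⟨hypersimplexColumns d (p k), Submodule.subset_span ⟨p k, rfl⟩⟩ := by
      apply (quotientLatticeEquiv hE hC).injective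
      rw [map_sum]
      simp only [map_nsmul, quotientLatticeEquiv_mkQ, hp]
      ext j
      simp [Finset.sum_apply, Pi.single_apply, h j]
    rw [hx]
    refine AddSubmonoid.sum_mem _ fun k _ => AddSubmonoid.nsmul_mem _ ?_ _
    exact AddSubmonoid.subset_closure ⟨p k, rfl⟩

theorem subdiagramVolume_eq_one (hE : 3 ≤ E.card)
    (hC : ∀ p, p ∈ faceColumns (hypersimplexColumns d) Γ ↔ p.1.1 ∈ E ∧ p.1.2 ∈ E) :
    subdiagramVolume (hypersimplexColumns d) Γ = 1 := by
  have hcard : Fintype.card {k // k ∉ E} =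
      Module.finrank ℤ (QuotientLattice (hypersimplexColumns d) Γ) := by
    rw [(quotientLatticeEquiv hE hC).finrank_eq, Module.finrank_fintype_fun_eq_card]
  let f : {k // k ∉ E} ≃ Fin (Module.finrank ℤ (QuotientLattice (hypersimplexColumns d) Γ)) :=
    Fintype.equivFinOfCardEq hcard
  have hvol := volume_subdiagram_of_basis (Module.finBasis ℤ (QuotientLattice (hypersimplexColumns d) Γ))
    ((Module.Basis.ofEquivFun (quotientLatticeEquiv hE hC)).reindex f)
    (quotientSemigroup (hypersimplexColumns d) Γ) (fun x => by
      rw [SetLike.mem_coe, mem_quotientSemigroup hE hC, ← f.symm.forall_congr_right]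
      simp)
  unfold subdiagramVolume
  have : ∀ X : Set (QuotientLattice (hypersimplexColumns d) Γ),
      quotientCoords (hypersimplexColumns d) Γ '' X = (fun x j => ((Module.finBasis ℤ
        (QuotientLattice (hypersimplexColumns d) Γ)).repr x j : ℝ)) '' X := fun X => rfl
  rw [this, this, hvol, mul_one_div_cancel (by positivity), Nat.floor_one]

theorem faceExponent_matroidPolytope (hE : 3 ≤ E.card) :
    faceExponent (hypersimplexColumns d) (matroidPolytope (uniformMatroid 2 E)) = 1 := by
  have hC := mem_faceColumns_matroidPolytope (d := d) (E := E) (by omega)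
  rw [faceExponent, faceIndex_eq_one hE hC, subdiagramVolume_eq_one hE hC]

end Exponents

/-! ### The principal `A`-determinant of the second hypersimplex -/

section Product

variable {d : ℕ}

/-- Stated for a general `g` so as to cover the product both with and without exponents. -/
theorem prod_faces_eq (g : Set (Fin d → ℝ) → MvPolynomial (Pairs d) ℂ)
    (hg : ∀ Γ, faceDiscriminant (hypersimplexColumns d) Γ = 1 → g Γ = 1) :
    ∏ Γ ∈ (finite_faces (hypersimplexColumns d)).toFinset, g Γ =
      ∏ E : Finset (Fin d) with 4 ≤ E.card, g (matroidPolytope (uniformMatroid 2 E)) := by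
  classical
  rw [← Finset.prod_image (s := Finset.univ.filter fun E : Finset (Fin d) => 4 ≤ E.card)
    (g := fun E => matroidPolytope (uniformMatroid 2 E)) (f := g)]
  · symm
    apply Finset.prod_subset
    · intro Γ hΓ
      obtain ⟨E, hE, rfl⟩ := Finset.mem_image.mp hΓ
      rw [Set.Finite.mem_toFinset]
      exact matroidPolytope_mem_faces (by have := (Finset.mem_filter.mp hE).2; omega)
    · intro Γ hΓ hn
      rw [Set.Finite.mem_toFinset] at hΓ
      rcases face_cases hΓ with ⟨E, hE, rfl⟩ | h
      · exact absurd (Finset.mem_image_of_mem _ (by simpa using hE)) hn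
      · exact hg Γ h
  · intro E hE E' hE' h
    have h1 : 4 ≤ E.card := by simpa using hE
    have h2 : 4 ≤ E'.card := by simpa using hE'
    exact matroidPolytope_injective (by omega) (by omega) h

theorem reducedPrincipalADeterminant_hypersimplex :
    reducedPrincipalADeterminant (hypersimplexColumns d) =
      ∏ E : Finset (Fin d) with 4 ≤ E.card,
        faceDiscriminant (hypersimplexColumns d) (matroidPolytope (uniformMatroid 2 E)) :=
  prod_faces_eq _ fun _ h => h

theorem principalADeterminant_hypersimplex :
    principalADeterminant (hypersimplexColumns d) =
      ∏ E : Finset (Fin d) with 4 ≤ E.card,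
        faceDiscriminant (hypersimplexColumns d) (matroidPolytope (uniformMatroid 2 E)) := by
  rw [principalADeterminant, prod_faces_eq _ fun _ h => by rw [h, one_pow]]
  refine Finset.prod_congr rfl fun E hE => ?_
  have : 4 ≤ E.card := (Finset.mem_filter.mp hE).2
  rw [faceExponent_matroidPolytope (by omega), pow_one]

theorem not_isUnit_faceDiscriminant_pow_iff {Γ : Set (Fin d → ℝ)}
    (hΓ : Γ ∈ faces (configPolytope (hypersimplexColumns d))) :
    ¬ IsUnit (faceDiscriminant (hypersimplexColumns d) Γ ^ faceExponent (hypersimplexColumns d) Γ) ↔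
      ∃ D : Finset (Fin d), 4 ≤ Dᶜ.card ∧
        Γ = matroidPolytope ((uniformMatroid 2 Finset.univ).delete (D : Set (Fin d))) := by
  simp only [uniformMatroid_delete]
  constructor
  · intro h
    rcases face_cases hΓ with ⟨E, hE, rfl⟩ | h1
    · exact ⟨Eᶜ, by rwa [compl_compl], by rw [compl_compl]⟩
    · rw [h1, one_pow] at h
      exact absurd isUnit_one h
  · rintro ⟨D, hD, rfl⟩
    rw [faceExponent_matroidPolytope (by omega), pow_one,
      (faceDiscriminant_matroidPolytope hD).isUnit_iff]
    exact not_isUnit_det_scalingSubmatrix hD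

end Product

end

theorem mainTheorem4 (d : ℕ) (hd : 4 ≤ d) :
    Associated (principalADeterminant (hypersimplexColumns d))
      (∏ E : Finset (Fin d) with 4 ≤ E.card,
        faceDiscriminant (hypersimplexColumns d) (matroidPolytope (uniformMatroid 2 E))) ∧
    (∀ E : Finset (Fin d), 4 ≤ E.card →
      matroidPolytope (uniformMatroid 2 E) ∈ faces (configPolytope (hypersimplexColumns d)) ∧
      Associated
        (faceDiscriminant (hypersimplexColumns d) (matroidPolytope (uniformMatroid 2 E)))
        (scalingSubmatrix E).det) ∧
    Associated (principalADeterminant (hypersimplexColumns d))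
      (∏ E : Finset (Fin d) with 4 ≤ E.card, (scalingSubmatrix E).det) ∧
    Associated (reducedPrincipalADeterminant (hypersimplexColumns d))
      (∏ E : Finset (Fin d) with 4 ≤ E.card, (scalingSubmatrix E).det) ∧
    ∀ Γ ∈ faces (configPolytope (hypersimplexColumns d)),
      ¬ IsUnit (faceDiscriminant (hypersimplexColumns d) Γ ^
          faceExponent (hypersimplexColumns d) Γ) ↔
        ∃ D : Finset (Fin d), 4 ≤ Dᶜ.card ∧
          Γ = matroidPolytope ((uniformMatroid 2 Finset.univ).delete (D : Set (Fin d))) := by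
  have hprod : Associated (∏ E : Finset (Fin d) with 4 ≤ E.card,
      faceDiscriminant (hypersimplexColumns d) (matroidPolytope (uniformMatroid 2 E)))
      (∏ E : Finset (Fin d) with 4 ≤ E.card, (scalingSubmatrix E).det) :=
    Associated.prod _ _ _ fun E hE =>
      faceDiscriminant_matroidPolytope (Finset.mem_filter.mp hE).2
  rw [principalADeterminant_hypersimplex, reducedPrincipalADeterminant_hypersimplex]
  exact ⟨Associated.refl _, fun E hE => ⟨matroidPolytope_mem_faces (by omega),
    faceDiscriminant_matroidPolytope hE⟩, hprod, hprod,
    fun Γ hΓ => not_isUnit_faceDiscriminant_pow_iff hΓ⟩
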